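/- Let $\mathcal A$ be a finite alphabet and $\mathcal F$ a finite set of forbidden patterns $w\in\mathcal A^{I(w)}$ with finite windows $I(w)\subset\mathbb Z$. Let $\sigma_k(x)_l=x_{k+l}$ be the shifts, $\Omega_{\mathcal F}\subset\mathcal A^{\mathbb Z}$ the subshift of finite type of the configurations in which no translate of a pattern of $\mathcal F$ occurs, and $\mathcal M_{\mathcal F}$ the set of shift-invariant Borel probability measures carried by $\Omega_{\mathcal F}$. For $\epsilon\in[0,1]$, let $\mathcal M_{\mathcal F}(\epsilon)$ be the set of the images, under the projection to $\mathcal A^{\mathbb Z}$, of the shift-invariant probability measures $\lambda$ on $(\mathcal A\times\{0,1\})^{\mathbb Z}$ such that $\lambda$-almost surely no pattern of $\mathcal F$ occurs on cells that all have second coordinate $0$, and such that a given cell has second coordinate $1$ with $\lambda$-probability at most $\epsilon$. For shift-invariant probability measures $\mu,\nu$ on $\mathcal A^{\mathbb Z}$ let $$d_B(\mu,\nu)=\inf_\lambda\int d_H(x,y)\,\mathrm d\lambda(x,y),\qquad d_H(x,y)=\limsup_{n\to\infty}\frac{|\{k\in[-n,n]:x_k\ne y_k\}|}{2n+1},$$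 where $\lambda$ runs over the shift-invariant couplings of $\mu$ and $\nu$, and let $d_B(\mu,\mathcal M_{\mathcal F})=\inf_{\nu\in\mathcal M_{\mathcal F}}d_B(\mu,\nu)$. Let $d=d(\mathcal F)=\max_{w\in\mathcal F}(\max I(w)-\min I(w))$ (a maximum over the empty set, and the contribution of an empty window, being $0$). The word automaton $G_{\mathcal F}$ is the directed graph whose states are the words of length $d+1$ over $\mathcal A$ that contain no translate of a pattern of $\mathcal F$, with transitions $au\to ub$ for $a,b\in\mathcal A$ and $u\in\mathcal A^{d}$. Two states communicate if there are paths of positive length between them in both directions; this is a partial equivalence relation, whose classes are the communication classes. Assume that $G_{\mathcal F}$ has a unique communication class and that it is aperiodic: the greatest common divisor of the lengths of the cycles of $G_{\mathcal F}$ is $1$. Then the subshift of finite type $\Omega_{\mathcal F}$ is linearly stable for $d_B$ on the class of all noises: there is a non-decreasing $f:[0,1]\to[0,\infty)$, right-continuous at $0$, with $f(0)=0$ and $f(\epsilon)=O(\epsilon)$ as $\epsilon\to0$, such that $d_B(\mu,\mathcal M_{\mathcal F})\le f(\epsilon)$ for all $\epsilon\in[0,1]$ and $\mu\in\mathcal M_{\mathcal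 F}(\epsilon)$. Explicitly, let $L(\Omega_{\mathcal F})$ be the set of finite words that occur in configurations of $\Omega_{\mathcal F}$. There is an $n_0\in\mathbb N$ such that for all $u,v\in L(\Omega_{\mathcal F})$ and all $n\ge n_0$ there is a word $w\in\mathcal A^n$ with $uwv\in L(\Omega_{\mathcal F})$. For every such $n_0$, with $k$ the number of states of $G_{\mathcal F}$ outside the communication class and $$C=\max\left(k,\left\lceil \tfrac d2\right\rceil\right),\qquad D=\max\left(C,\left\lceil\tfrac{n_0}2\right\rceil\right),\qquad E=D+\left\lceil\tfrac d2\right\rceil,$$ one has $d_B(\mu,\mathcal M_{\mathcal F})\le 3(2E+1)\epsilon$ for all $\epsilon\in[0,1]$ and $\mu\in\mathcal M_{\mathcal F}(\epsilon)$. -/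

import Mathlib

open MeasureTheory Filter Topology Asymptotics
open scoped ENNReal

namespace NoisySFT

/-! ### Configurations, patterns and subshifts of finite type over `ℤ` -/

/-- The shift `σ_k` on `A^ℤ`, with `σ_k(x)_l = x_{k+l}`. -/
def shift {A : Type*} (k : ℤ) (x : ℤ → A) : ℤ → A := fun l => x (k + l)

/-- A finite pattern: a finite window `I ⊆ ℤ` together with an element of `A^I`. -/
abbrev Pattern (A : Type*) := (I : Finset ℤ) × (I → A)

/-- The SFT `Ω_F`: the configurations in which no translate of a pattern of `F` occurs. -/
def sft {A : Type*} (F : Finset (Pattern A)) : Set (ℤ → A) :=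
  {x | ∀ p ∈ F, ∀ k : ℤ, ¬ ∀ i : p.1, shift k x i = p.2 i}

/-- The `σ`-invariant probability measures on `A^ℤ`. -/
def invariantMeasures (A : Type*) [MeasurableSpace A] : Set (Measure (ℤ → A)) :=
  {μ | IsProbabilityMeasure μ ∧ ∀ k : ℤ, μ.map (shift k) = μ}

/-- `M_F`: the `σ`-invariant probability measures carried by `Ω_F`. -/
def sftMeasures {A : Type*} [MeasurableSpace A] (F : Finset (Pattern A)) :
    Set (Measure (ℤ → A)) :=
  {μ | μ ∈ invariantMeasures A ∧ ∀ᵐ x ∂μ, x ∈ sft F}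

/-! ### Noise: a cell of `A × Bool` is clear if its second coordinate is `false`, and
obscured if it is `true` -/

/-- The pattern `(w, 0^I)` over `A × Bool`. -/
def clearPattern {A : Type*} (p : Pattern A) : Pattern (A × Bool) :=
  ⟨p.1, fun i => (p.2 i, false)⟩

open Classical in
/-- The set of forbidden clear patterns over `A × Bool`. -/
noncomputable def clearForbidden {A : Type*} (F : Finset (Pattern A)) :
    Finset (Pattern (A × Bool)) :=
  F.image clearPattern

/-- The class of all noises: all `σ`-invariant probability measures on `{0,1}^ℤ`. -/
def allNoises : Set (Measure (ℤ → Bool)) := invariantMeasures Bool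

/-- `ν` is an `ε`-noise: it is `σ`-invariant and a given cell is obscured with probability
at most `ε`. -/
def IsNoise (ε : ℝ) (ν : Measure (ℤ → Bool)) : Prop :=
  ν ∈ allNoises ∧ ν {b | b 0 = true} ≤ ENNReal.ofReal ε

/-- The invariant measures on noisy configurations without forbidden clear patterns, whose
noise is an `ε`-noise of the class `N`. -/
def noisyMeasures {A : Type*} [MeasurableSpace A] (F : Finset (Pattern A))
    (N : Set (Measure (ℤ → Bool))) (ε : ℝ) : Set (Measure (ℤ → A × Bool)) :=
  {l | l ∈ sftMeasures (clearForbidden F) ∧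
    l.map (fun ω k => (ω k).2) ∈ N ∧ IsNoise ε (l.map (fun ω k => (ω k).2))}

/-- `M_F^N(ε)`: the projections to `A^ℤ` of the measures in `noisyMeasures F N ε`. -/
def projectedNoisyMeasures {A : Type*} [MeasurableSpace A] (F : Finset (Pattern A))
    (N : Set (Measure (ℤ → Bool))) (ε : ℝ) : Set (Measure (ℤ → A)) :=
  (fun l => l.map (fun ω k => (ω k).1)) '' noisyMeasures F N ε

/-! ### The Besicovitch distance -/

open Classical in
/-- The Hamming-Besicovitch pseudo-distance: the upper density, along the boxes `[-n, n]`, of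
the set of cells where `x` and `y` differ. -/
noncomputable def hammingBesicovitch {A : Type*} (x y : ℤ → A) : ℝ≥0∞ :=
  limsup (fun n : ℕ =>
    (((Finset.Icc (-(n : ℤ)) n).filter (fun k => x k ≠ y k)).card : ℝ≥0∞)
      / ((2 * n + 1 : ℕ) : ℝ≥0∞)) atTop

/-- The `σ`-invariant couplings of `μ` and `ν`. -/
def couplings {A : Type*} [MeasurableSpace A] (μ ν : Measure (ℤ → A)) :
    Set (Measure (ℤ → A × A)) :=
  {l | l ∈ invariantMeasures (A × A) ∧
    l.map (fun z k => (z k).1) = μ ∧ l.map (fun z k => (z k).2) = ν}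

/-- The Besicovitch distance `d_B(μ, ν)`. -/
noncomputable def besicovitch {A : Type*} [MeasurableSpace A] (μ ν : Measure (ℤ → A)) : ℝ≥0∞ :=
  ⨅ l ∈ couplings μ ν, ∫⁻ z, hammingBesicovitch (fun k => (z k).1) (fun k => (z k).2) ∂l

/-! ### Stability -/

/-- The SFT induced by `F` is `f`-stable for the distance `d` on the class of noises `N`. Only
the values of `f` on `[0,1]` matter. -/
def IsStable {A : Type*} [MeasurableSpace A] (F : Finset (Pattern A))
    (d : Measure (ℤ → A) → Measure (ℤ → A) → ℝ≥0∞) (N : Set (Measure (ℤ → Bool)))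
    (f : ℝ → ℝ) : Prop :=
  MonotoneOn f (Set.Icc 0 1) ∧ (∀ ε ∈ Set.Icc (0 : ℝ) 1, 0 ≤ f ε) ∧ f 0 = 0 ∧
    ContinuousWithinAt f (Set.Icc 0 1) 0 ∧
    ∀ ε ∈ Set.Icc (0 : ℝ) 1,
      (⨆ μ ∈ projectedNoisyMeasures F N ε, ⨅ ν ∈ sftMeasures F, d μ ν) ≤ ENNReal.ofReal (f ε)

/-- Linear stability: `f`-stability for some `f` with `f(ε) = O(ε)` as `ε → 0`. -/
def IsLinearlyStable {A : Type*} [MeasurableSpace A] (F : Finset (Pattern A))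
    (d : Measure (ℤ → A) → Measure (ℤ → A) → ℝ≥0∞) (N : Set (Measure (ℤ → Bool))) : Prop :=
  ∃ f : ℝ → ℝ, IsStable F d N f ∧ f =O[𝓝[Set.Icc 0 1] 0] (fun ε => ε)

/-! ### The word automaton -/

/-- `d(I) = max I - min I` (and `0` for the empty window). -/
def windowDiam (I : Finset ℤ) : ℕ :=
  if h : I.Nonempty then (I.max' h - I.min' h).toNat else 0

/-- `d(F)`, the maximal diameter of the window of a pattern of `F` (and `0` if `F = ∅`). -/
def diam {A : Type*} (F : Finset (Pattern A)) : ℕ := F.sup (fun p => windowDiam p.1)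

/-- The word `u`, on the window `{0, …, n-1}`, contains no translate of a pattern of `F`. -/
def LocallyAdmissible {A : Type*} (F : Finset (Pattern A)) {n : ℕ} (u : Fin n → A) : Prop :=
  ∀ p ∈ F, ∀ k : ℤ, ¬ ∀ i : p.1, ∃ j : Fin n, (j : ℤ) = k + i ∧ u j = p.2 i

/-- The states of the word automaton `G_F`: the locally admissible words on `d(F) + 1`
consecutive cells, which is the least number of consecutive cells that can hold every pattern
of `F`. -/
abbrev State {A : Type*} (F : Finset (Pattern A)) :=
  {u : Fin (diam F + 1) → A // LocallyAdmissible F u}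

/-- The transitions `au → ub` of `G_F`. -/
def Step {A : Type*} {F : Finset (Pattern A)} (s t : State F) : Prop :=
  ∀ i : Fin (diam F), s.1 i.succ = t.1 i.castSucc

/-- There is a path of length `n` (that is, with `n` transitions) from `s` to `t` in `G_F`. -/
def HasPath {A : Type*} {F : Finset (Pattern A)} (n : ℕ) (s t : State F) : Prop :=
  ∃ p : ℕ → State F, p 0 = s ∧ p n = t ∧ ∀ i < n, Step (p i) (p (i + 1))

/-- Two states communicate if there are paths in both directions. Paths have positive length
here, so that a state through which no cycle passes does not communicate with itself. -/
def Communicate {A : Type*} {F : Finset (Pattern A)} (s t : State F) : Prop :=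
  (∃ n > 0, HasPath n s t) ∧ (∃ n > 0, HasPath n t s)

/-- The communication classes of `G_F`, that is the classes of the partial equivalence relation
`Communicate`. -/
def IsCommunicationClass {A : Type*} (F : Finset (Pattern A)) (C : Set (State F)) : Prop :=
  ∃ s : State F, Communicate s s ∧ C = {t | Communicate s t}

/-- `G_F` is irreducible: it has a unique communication class. -/
def IsIrreducible {A : Type*} (F : Finset (Pattern A)) : Prop :=
  ∃! C : Set (State F), IsCommunicationClass F C

/-- The lengths of the cycles of `G_F`. -/
def cycleLengths {A : Type*} (F : Finset (Pattern A)) : Set ℕ :=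
  {n | 0 < n ∧ ∃ s : State F, HasPath n s s}

/-- `G_F` is `p`-periodic: it is irreducible and `p` is the greatest common divisor of the
lengths of its cycles. -/
def IsPeriodic {A : Type*} (F : Finset (Pattern A)) (p : ℕ) : Prop :=
  IsIrreducible F ∧ (∀ n ∈ cycleLengths F, p ∣ n) ∧
    ∀ q : ℕ, (∀ n ∈ cycleLengths F, q ∣ n) → q ∣ p

/-- `G_F` is aperiodic: it has a unique communication class, of period one. -/
def IsAperiodic {A : Type*} (F : Finset (Pattern A)) : Prop := IsPeriodic F 1

/-! ### The explicit constant -/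

/-- The word `u` is globally admissible: it belongs to the language `L(Ω_F)`. -/
def GloballyAdmissible {A : Type*} (F : Finset (Pattern A)) {n : ℕ} (u : Fin n → A) : Prop :=
  ∃ x ∈ sft F, ∃ k : ℤ, ∀ i : Fin n, x (k + (i : ℤ)) = u i

/-- Any two words of `L(Ω_F)` can be glued with any gap of size `n ≥ n₀`. -/
def IsGluingConstant {A : Type*} (F : Finset (Pattern A)) (n₀ : ℕ) : Prop :=
  ∀ (m l : ℕ) (u : Fin m → A) (v : Fin l → A),
    GloballyAdmissible F u → GloballyAdmissible F v →
    ∀ n ≥ n₀, ∃ w : Fin n → A, GloballyAdmissible F (Fin.append (Fin.append u w) v)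

/-- The number of states of `G_F` that lie in no communication class. -/
noncomputable def transientCount {A : Type*} (F : Finset (Pattern A)) : ℕ :=
  Nat.card {s : State F // ¬ Communicate s s}

/-- `E = max (C, ⌈n₀/2⌉) + ⌈d(F)/2⌉`, where `C = max (k, ⌈d(F)/2⌉)` and `k` is the number of
states in no communication class. Note that `(m + 1) / 2` in `ℕ` is `⌈m/2⌉`. -/
noncomputable def constE {A : Type*} (F : Finset (Pattern A)) (n₀ : ℕ) : ℕ :=
  max (max (transientCount F) ((diam F + 1) / 2)) ((n₀ + 1) / 2) + (diam F + 1) / 2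

end NoisySFT

/-!
The distance is bounded by an explicit repair of the noisy configurations.

Since the communication class is unique, the transient states of the word automaton can only be
visited near the two ends of a path, each of them once. Hence a word which is clear, together with
`D ≥ k` further cells on both sides, is a recurrent state, and so it occurs in `Ω_F`
(`Anchor.globallyAdmissible`). The positions `p` of such words of length `d + 1` are the *anchors*
of a noisy configuration. Two consecutive anchors are either adjacent cells, or they are separated
by an obscured cell and by a gap of at least `2 D + 1 ≥ n₀` cells, which the gluing constant allows
to fill by a choice that depends only on the two words and on the length of the gap (`bridge`).
As the words at the anchors are longer than any forbidden window, the configuration `glue F D ω`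
obtained this way lies in `Ω_F` (`glue_mem_sft`). It commutes with the shifts, and it differs from
`ω` only at cells within distance `E = D + ⌈d/2⌉` of an obscured cell (`glue_eq_proj`).

By Poincaré recurrence, almost surely a configuration has either no anchor or anchors on both sides
arbitrarily far away (`ae_anchored`). In the former case every cell is within distance `E` of an
obscured one, and an independent configuration drawn from the invariant measure of a periodic orbit
of `Ω_F` serves instead of `glue F D ω` (`repair`). This gives an invariant coupling of `μ` with a
measure in `M_F`, for which the two configurations differ at the cell `0` with probability at most
`(2 E + 1) ε`.

It remains to bound the mean of the upper density `d_H` by the probability of a mismatch at `0`.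
The maximal ergodic theorem, applied to the indicator of the mismatch minus its upper frequency
along the orbit, does this for one-sided frequencies (`integral_upperFreq_le`). The boxes `[-n, n]`
are covered by a forward and a backward stretch, at the price of a factor `2`, which is within the
factor `3` of the claim.

For the existence of `n₀`, the return times to a recurrent state form a semigroup of greatest common
divisor `1`, which contains all large integers (`IsAperiodic.exists_hasPath`).
-/

namespace NoisySFT

/-! ### Windows of configurations -/

/-- The word of length `d(F) + 1` that `x` shows at the cells `j, …, j + d(F)`. -/
def window {A : Type*} (F : Finset (Pattern A)) (x : ℤ → A) (j : ℤ) : Fin (diam F + 1) → A :=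
  fun i => x (j + (i : ℤ))

lemma window_eq_iff {A : Type*} {F : Finset (Pattern A)} {x y : ℤ → A} {j k : ℤ} :
    window F x j = window F y k ↔ ∀ m : ℤ, 0 ≤ m → m ≤ diam F → x (j + m) = y (k + m) := by
  constructor
  · intro h m hm hm'
    have := congrFun h ⟨m.toNat, by omega⟩
    simpa [window, Int.toNat_of_nonneg hm] using this
  · intro h
    funext i
    exact h i (by positivity) (by have := i.2; omega)

lemma sub_le_diam {A : Type*} {F : Finset (Pattern A)} {p : Pattern A} (hp : p ∈ F) {i j : ℤ}
    (hi : i ∈ p.1) (hj : j ∈ p.1) : j - i ≤ diam F := by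
  have h1 : windowDiam p.1 ≤ diam F := Finset.le_sup (f := fun p : Pattern A => windowDiam p.1) hp
  have hne : p.1.Nonempty := ⟨i, hi⟩
  rw [windowDiam, dif_pos hne] at h1
  have h2 := p.1.min'_le i hi
  have h3 := p.1.le_max' j hj
  omega

lemma mem_sft_iff_window {A : Type*} {F : Finset (Pattern A)} {x : ℤ → A} :
    x ∈ sft F ↔ ∀ j, LocallyAdmissible F (window F x j) := by
  constructor
  · intro hx j p hp k hk
    refine hx p hp (j + k) fun i => ?_
    obtain ⟨m, hm, he⟩ := hk i
    rw [← he, window, shift, hm, add_assoc]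
  · intro h p hp k hk
    rcases p.1.eq_empty_or_nonempty with he | hne
    · refine h 0 p hp 0 fun i => absurd i.2 ?_
      simp [he]
    · refine h (k + p.1.min' hne) p hp (-p.1.min' hne) fun i => ?_
      have h1 := p.1.min'_le i i.2
      have h2 := sub_le_diam hp (p.1.min'_mem hne) i.2
      refine ⟨⟨(i - p.1.min' hne : ℤ).toNat, by omega⟩, ?_, ?_⟩
      · simp only [Int.toNat_of_nonneg (sub_nonneg.2 h1)]; ring
      · rw [← hk i, window, shift]
        congr 1
        simp only [Int.toNat_of_nonneg (sub_nonneg.2 h1)]; ring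

/-! ### Paths in the word automaton -/

lemma step_window {A : Type*} {F : Finset (Pattern A)} {x : ℤ → A} {j : ℤ}
    {h : LocallyAdmissible F (window F x j)} {h' : LocallyAdmissible F (window F x (j + 1))} :
    Step (F := F) ⟨window F x j, h⟩ ⟨window F x (j + 1), h'⟩ := by
  intro i
  simp only [window]
  congr 1
  push_cast [Fin.val_succ, Fin.val_castSucc]
  ring

lemma HasPath.trans {A : Type*} {F : Finset (Pattern A)} {m n : ℕ} {s t u : State F}
    (h : HasPath m s t) (h' : HasPath n t u) : HasPath (m + n) s u := by
  obtain ⟨p, hp0, hpm, hp⟩ := h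
  obtain ⟨q, hq0, hqn, hq⟩ := h'
  refine ⟨fun i => if i < m then p i else q (i - m), ?_, ?_, fun i hi => ?_⟩
  · rcases Nat.eq_zero_or_pos m with rfl | hm
    · simp [hq0, ← hpm, hp0]
    · simp [hm, hp0]
  · simp [hqn]
  · rcases lt_trichotomy (i + 1) m with h | h | h
    · simpa [h, show i < m by omega] using hp i (by omega)
    · subst h
      simpa [hq0, hpm] using hp i (by omega)
    · have := hq (i - m) (by omega)
      simpa [show ¬ i < m by omega, show ¬ i + 1 < m by omega,
        show i + 1 - m = i - m + 1 by omega] using this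

lemma hasPath_of_step {A : Type*} {F : Finset (Pattern A)} (e : ℤ → State F) {a b : ℤ}
    (hab : a ≤ b) (h : ∀ j, a ≤ j → j < b → Step (e j) (e (j + 1))) :
    HasPath (b - a).toNat (e a) (e b) := by
  refine ⟨fun i => e (a + i), by simp, congrArg e (by omega), fun i hi => ?_⟩
  have := h (a + i) (by omega) (by omega)
  simpa [add_assoc] using this

lemma Communicate.symm {A : Type*} {F : Finset (Pattern A)} {s t : State F}
    (h : Communicate s t) : Communicate t s := ⟨h.2, h.1⟩

lemma Communicate.trans {A : Type*} {F : Finset (Pattern A)} {s t u : State F}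
    (h : Communicate s t) (h' : Communicate t u) : Communicate s u := by
  obtain ⟨⟨a, ha, pa⟩, ⟨b, hb, pb⟩⟩ := h
  obtain ⟨⟨c, hc, pc⟩, ⟨e, he, pe⟩⟩ := h'
  exact ⟨⟨_, by omega, pa.trans pc⟩, ⟨_, by omega, pe.trans pb⟩⟩

lemma IsIrreducible.communicate {A : Type*} {F : Finset (Pattern A)} (hF : IsIrreducible F)
    {s t : State F} (hs : Communicate s s) (ht : Communicate t t) : Communicate s t := by
  have h := hF.unique ⟨s, hs, rfl⟩ ⟨t, ht, rfl⟩
  have : t ∈ {u | Communicate t u} := ht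
  rwa [← h] at this

/-- A stretch of a path which visits more states than there are transient ones visits a
recurrent state, since a state that is visited twice lies on a cycle. -/
lemma exists_recurrent {A : Type*} [Finite A] {F : Finset (Pattern A)} (e : ℤ → State F) {a : ℤ}
    (h : ∀ j, a ≤ j → j < a + transientCount F → Step (e j) (e (j + 1))) :
    ∃ j, a ≤ j ∧ j ≤ a + transientCount F ∧ Communicate (e j) (e j) := by
  by_contra! hcon
  have hinj : Function.Injective (fun i : Fin (transientCount F + 1) =>
      (⟨e (a + i), hcon _ (by omega) (by have := i.2; omega)⟩ :
        {s : State F // ¬ Communicate s s})) := by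
    have key : ∀ i j : Fin (transientCount F + 1), i < j → e (a + i) ≠ e (a + j) := by
      intro i j hij he
      have hlt : (i : ℕ) < j := hij
      have hp := hasPath_of_step e (a := a + i) (b := a + j) (by omega)
        (fun l hl hl' => h l (by omega) (by have := j.2; omega))
      rw [← he] at hp
      exact hcon (a + i) (by omega) (by have := i.2; omega)
        ⟨⟨_, by omega, hp⟩, ⟨_, by omega, hp⟩⟩
    intro i j hij
    have he : e (a + i) = e (a + j) := congrArg Subtype.val hij
    rcases lt_trichotomy i j with hlt | heq | hlt
    · exact absurd he (key i j hlt)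
    · exact heq
    · exact absurd he.symm (key j i hlt)
  have := Nat.card_le_card_of_injective _ hinj
  rw [Nat.card_eq_fintype_card, Fintype.card_fin] at this
  unfold transientCount at this
  omega

/-- By uniqueness of the communication class, a state on a path is recurrent as soon as the path
continues for as many steps as there are transient states, both before and after it. -/
lemma IsIrreducible.recurrent_of_path {A : Type*} [Finite A] {F : Finset (Pattern A)}
    (hF : IsIrreducible F) (e : ℤ → State F) {j : ℤ}
    (h : ∀ i, j - transientCount F ≤ i → i < j + transientCount F → Step (e i) (e (i + 1))) :
    Communicate (e j) (e j) := by
  obtain ⟨a, ha, ha', hca⟩ := exists_recurrent e (a := j - transientCount F)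
    (fun i hi hi' => h i hi (by omega))
  obtain ⟨b, hb, hb', hcb⟩ := exists_recurrent e (a := j) (fun i hi hi' => h i (by omega) hi')
  rcases eq_or_ne a j with rfl | haj
  · exact hca
  have p1 := hasPath_of_step e (a := a) (b := j) (by omega)
    (fun i hi hi' => h i (by omega) (by omega))
  have p2 := hasPath_of_step e (a := j) (b := b) (by omega)
    (fun i hi hi' => h i (by omega) (by omega))
  obtain ⟨-, n, hn, p3⟩ := hF.communicate hca hcb
  have p := (p2.trans p3).trans p1
  exact ⟨⟨_, by omega, p⟩, ⟨_, by omega, p⟩⟩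

lemma IsIrreducible.recurrent_window {A : Type*} [Finite A] {F : Finset (Pattern A)}
    (hF : IsIrreducible F) {x : ℤ → A} {j : ℤ}
    (h : ∀ i, j - transientCount F ≤ i → i ≤ j + transientCount F →
      LocallyAdmissible F (window F x i)) :
    Communicate (F := F) ⟨window F x j, h j (by omega) (by omega)⟩
      ⟨window F x j, h j (by omega) (by omega)⟩ := by
  classical
  let e : ℤ → State F := fun i =>
    if hi : LocallyAdmissible F (window F x i) then ⟨_, hi⟩
    else ⟨_, h j (by omega) (by omega)⟩
  have he : ∀ i (hi : LocallyAdmissible F (window F x i)), e i = ⟨_, hi⟩ := fun i hi => dif_pos hi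
  have := hF.recurrent_of_path e (j := j) fun i hi hi' => by
    rw [he i (h i hi hi'.le), he (i + 1) (h _ (by omega) (by omega))]
    exact step_window
  rwa [he j (h j (by omega) (by omega))] at this

/-! ### Configurations read along bi-infinite paths -/

/-- The configuration spelled by the first letters of the states `e j`. -/
def readPath {A : Type*} {F : Finset (Pattern A)} (e : ℤ → State F) : ℤ → A := fun j => (e j).1 0

lemma window_readPath {A : Type*} {F : Finset (Pattern A)} {e : ℤ → State F}
    (h : ∀ j, Step (e j) (e (j + 1))) (j : ℤ) : window F (readPath e) j = (e j).1 := by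
  have key : ∀ m : ℕ, ∀ (hm : m < diam F + 1) (j : ℤ), (e (j + m)).1 0 = (e j).1 ⟨m, hm⟩ := by
    intro m
    induction m with
    | zero => intro hm j; simp
    | succ m ih =>
      intro hm j
      have h1 := ih (by omega) (j + 1)
      have h2 := h j ⟨m, by omega⟩
      rw [show j + ((m + 1 : ℕ) : ℤ) = j + 1 + m by push_cast; ring, h1]
      exact h2.symm
  funext i
  exact key i i.2 j

lemma readPath_mem_sft {A : Type*} {F : Finset (Pattern A)} {e : ℤ → State F}
    (h : ∀ j, Step (e j) (e (j + 1))) : readPath e ∈ sft F := by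
  rw [mem_sft_iff_window]
  intro j
  rw [window_readPath h]
  exact (e j).2

/-- A cycle through `s` can be followed forever in both directions. -/
lemma exists_periodic_path {A : Type*} {F : Finset (Pattern A)} {s : State F} {n : ℕ}
    (hn : 0 < n) (h : HasPath n s s) :
    ∃ e : ℤ → State F, e 0 = s ∧ (∀ j, Step (e j) (e (j + 1))) ∧ ∀ j, e (j + n) = e j := by
  obtain ⟨p, hp0, hpn, hp⟩ := h
  refine ⟨fun j => p (j % n).toNat, by simpa using hp0, fun j => ?_, fun j => by simp⟩
  have hn' : (0 : ℤ) < n := by exact_mod_cast hn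
  have h0 := Int.emod_nonneg j hn'.ne'
  have h1 := Int.emod_lt_of_pos j hn'
  have hs := hp (j % n).toNat (by omega)
  have h2 : (j + 1) % n = (j % n + 1) % n := by simp
  rcases eq_or_lt_of_le (show j % n + 1 ≤ n by omega) with h3 | h3
  · have h4 : (j + 1) % n = 0 := by rw [h2, h3, Int.emod_self]
    have h5 : (j % n).toNat + 1 = n := by omega
    simp only [h4]
    rw [h5, hpn, ← hp0] at hs
    exact hs
  · have h4 : (j + 1) % n = j % n + 1 := by rw [h2, Int.emod_eq_of_lt (by omega) h3]
    simp only [h4]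
    rwa [show (j % n + 1).toNat = (j % n).toNat + 1 by omega]

lemma Communicate.exists_mem_sft {A : Type*} {F : Finset (Pattern A)} {s : State F}
    (h : Communicate s s) : ∃ z ∈ sft F, window F z 0 = s.1 := by
  obtain ⟨⟨n, hn, hp⟩, -⟩ := h
  obtain ⟨e, he0, hstep, -⟩ := exists_periodic_path hn hp
  exact ⟨readPath e, readPath_mem_sft hstep, by rw [window_readPath hstep, he0]⟩

/-! ### Existence of a gluing constant -/

/-- In an aperiodic automaton, any two recurrent states are joined by paths of all sufficiently
large lengths. -/
lemma IsAperiodic.exists_hasPath {A : Type*} [Finite A] {F : Finset (Pattern A)}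
    (hF : IsAperiodic F) :
    ∃ N : ℕ, ∀ s t : State F, Communicate s s → Communicate t t → ∀ n ≥ N, HasPath n s t := by
  obtain ⟨hirr, -, hgcd⟩ := hF
  -- the return times to a recurrent state `s` form a semigroup of gcd one
  have hret : ∀ s : State F, Communicate s s → ∃ N : ℕ, ∀ n ≥ N, HasPath n s s := by
    intro s hs
    have hone : Nat.setGcd {n | HasPath n s s} ∣ 1 := by
      refine hgcd _ ?_
      rintro n ⟨hn, t, ht⟩
      have hct : Communicate t t := ⟨⟨n, hn, ht⟩, ⟨n, hn, ht⟩⟩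
      obtain ⟨⟨a, -, pa⟩, ⟨b, -, pb⟩⟩ := hirr.communicate hs hct
      have h1 : Nat.setGcd {n | HasPath n s s} ∣ a + b := Nat.setGcd_dvd_of_mem (pa.trans pb)
      have h2 : Nat.setGcd {n | HasPath n s s} ∣ a + n + b :=
        Nat.setGcd_dvd_of_mem ((pa.trans ht).trans pb)
      have h3 : a + n + b = (a + b) + n := by ring
      rw [h3] at h2
      exact (Nat.dvd_add_right h1).1 h2
    obtain ⟨N, hN⟩ := Nat.exists_mem_closure_of_ge {n | HasPath n s s}
    refine ⟨N, fun n hn => ?_⟩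
    refine AddSubmonoid.closure_induction (motive := fun n _ => HasPath n s s) (fun m hm => hm) ?_
      (fun _ _ _ _ h1 h2 => h1.trans h2) (hN n hn (hone.trans (one_dvd n)))
    exact ⟨fun _ => s, rfl, rfl, fun i hi => absurd hi (by omega)⟩
  have hpair : ∀ q : State F × State F, ∃ N : ℕ, Communicate q.1 q.1 → Communicate q.2 q.2 →
      ∀ n ≥ N, HasPath n q.1 q.2 := by
    rintro ⟨s, t⟩
    by_cases hs : Communicate s s
    · by_cases ht : Communicate t t
      · obtain ⟨N, hN⟩ := hret s hs
        obtain ⟨⟨a, -, pa⟩, -⟩ := hirr.communicate hs ht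
        refine ⟨N + a, fun _ _ n hn => ?_⟩
        have := (hN (n - a) (by omega)).trans pa
        rwa [show n - a + a = n by omega] at this
      · exact ⟨0, fun _ h => absurd h ht⟩
    · exact ⟨0, fun h => absurd h hs⟩
  choose N hN using hpair
  obtain ⟨M, hM⟩ := (Set.finite_range N).bddAbove
  exact ⟨M, fun s t hs ht n hn =>
    hN (s, t) hs ht n ((hM (Set.mem_range_self (s, t))).trans hn)⟩

lemma IsAperiodic.exists_isGluingConstant {A : Type*} [Finite A] {F : Finset (Pattern A)}
    (hF : IsAperiodic F) : ∃ n₀ : ℕ, IsGluingConstant F n₀ := by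
  obtain ⟨N, hN⟩ := hF.exists_hasPath
  refine ⟨N, ?_⟩
  rintro m l u v ⟨x, hx, k, hxu⟩ ⟨y, hy, k', hyv⟩ n hn
  have hx' := mem_sft_iff_window.1 hx
  have hy' := mem_sft_iff_window.1 hy
  -- the last window of `u` and the first window of `v` are joined by a path of length `n + d + 1`
  have hs := hF.1.recurrent_window (x := x) (j := k + m - (diam F + 1)) fun i _ _ => hx' i
  have ht := hF.1.recurrent_window (x := y) (j := k') fun i _ _ => hy' i
  obtain ⟨p, hp0, hpn, hp⟩ := hN _ _ hs ht (n + (diam F + 1)) (by omega)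
  let e : ℤ → State F := fun j =>
    if j < 0 then ⟨_, hx' (k + m - (diam F + 1) + j)⟩
    else if j < n + (diam F + 1) then p j.toNat else ⟨_, hy' (k' + (j - (n + (diam F + 1))))⟩
  have he0 : ∀ j ≤ 0, e j = ⟨_, hx' (k + m - (diam F + 1) + j)⟩ := by
    intro j hj
    rcases hj.lt_or_eq with h | rfl
    · simp only [e, if_pos h]
    · have : (0 : ℤ) < n + (diam F + 1) := by omega
      simp [e, if_pos this, hp0]
  have he1 : ∀ j : ℤ, 0 ≤ j → j ≤ n + (diam F + 1) → e j = p j.toNat := by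
    intro j hj hj'
    rcases hj'.lt_or_eq with h | rfl
    · simp only [e, if_neg hj.not_gt, if_pos h]
    · simp only [e, if_neg hj.not_gt, if_neg (lt_irrefl _), sub_self]
      rw [show ((n : ℤ) + (diam F + 1)).toNat = n + (diam F + 1) by omega, hpn]
      simp
  have he2 : ∀ j : ℤ, n + (diam F + 1) ≤ j → e j = ⟨_, hy' (k' + (j - (n + (diam F + 1))))⟩ := by
    intro j hj
    simp only [e, if_neg (show ¬ j < 0 by omega), if_neg hj.not_gt]
  have hstep : ∀ j, Step (e j) (e (j + 1)) := by
    intro j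
    rcases lt_or_ge j 0 with h | h
    · rw [he0 j h.le, he0 (j + 1) (by omega)]
      have := step_window (h := hx' (k + m - (diam F + 1) + j)) (h' := hx' _)
      simpa only [add_assoc] using this
    rcases lt_or_ge j (n + (diam F + 1)) with h' | h'
    · rw [he1 j h h'.le, he1 (j + 1) (by omega) (by omega),
        show (j + 1).toNat = j.toNat + 1 by omega]
      exact hp _ (by omega)
    · rw [he2 j h', he2 (j + 1) (by omega)]
      have := step_window (h := hy' (k' + (j - (n + (diam F + 1))))) (h' := hy' _)
      simpa only [add_assoc, add_sub_right_comm] using this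
  have hz := readPath_mem_sft hstep
  -- reading a window anywhere inside the state at `j`
  have hread : ∀ (j i : ℤ) (_ : 0 ≤ i) (_ : i ≤ diam F),
      readPath e (j + i) = (e j).1 ⟨i.toNat, by omega⟩ := by
    intro j i hi hi'
    rw [← window_readPath hstep j, window]
    simp [Int.toNat_of_nonneg hi]
  have hzx : ∀ i : ℤ, i ≤ diam F → readPath e i = x (k + m - (diam F + 1) + i) := by
    intro i hi
    rcases le_or_gt i 0 with h | h
    · have := hread i 0 le_rfl (Int.natCast_nonneg _)
      rw [he0 i h] at this
      simpa [window] using this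
    · have := hread 0 i h.le hi
      rw [he0 0 le_rfl] at this
      simpa [window, Int.toNat_of_nonneg h.le] using this
  have hzy : ∀ i : ℤ, n + (diam F + 1) ≤ i →
      readPath e i = y (k' + (i - (n + (diam F + 1)))) := by
    intro i hi
    have := hread i 0 le_rfl (Int.natCast_nonneg _)
    rw [he2 i hi] at this
    simpa [window] using this
  refine ⟨fun i => readPath e (diam F + 1 + i), readPath e, hz, diam F + 1 - m, fun i => ?_⟩
  refine Fin.addCases (fun i => ?_) (fun i => ?_) i
  · rw [Fin.append_left]
    refine Fin.addCases (fun i => ?_) (fun i => ?_) i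
    · rw [Fin.append_left, ← hxu, hzx _ (by simp; have := i.2; omega)]
      congr 1
      simp
      ring
    · rw [Fin.append_right]
      congr 1
      simp
      ring
  · rw [Fin.append_right, ← hyv, hzy _ (by simp; omega)]
    congr 1
    simp
    ring

/-! ### Anchors of a noisy configuration -/

/-- `p` is an anchor of `ω` at depth `D`: the window `p, …, p + d(F)` and the `D` cells on either
side of it are clear. -/
def Anchor {A : Type*} (F : Finset (Pattern A)) (D : ℕ) (ω : ℤ → A × Bool) (p : ℤ) : Prop :=
  ∀ j, p - D ≤ j → j ≤ p + diam F + D → (ω j).2 = false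

/-- `ω` has anchors arbitrarily far on both sides. -/
def Anchored {A : Type*} (F : Finset (Pattern A)) (D : ℕ) (ω : ℤ → A × Bool) : Prop :=
  ∀ m : ℤ, (∃ p ≤ m, Anchor F D ω p) ∧ ∃ p > m, Anchor F D ω p

/-- `p` is the last anchor at or before the cell `l`. -/
def IsPrevAnchor {A : Type*} (F : Finset (Pattern A)) (D : ℕ) (ω : ℤ → A × Bool) (l p : ℤ) :
    Prop :=
  IsGreatest {p | p ≤ l ∧ Anchor F D ω p} p

/-- `q` is the first anchor after the cell `l`. -/
def IsNextAnchor {A : Type*} (F : Finset (Pattern A)) (D : ℕ) (ω : ℤ → A × Bool) (l q : ℤ) :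
    Prop :=
  IsLeast {q | l < q ∧ Anchor F D ω q} q

lemma anchor_shift {A : Type*} {F : Finset (Pattern A)} {D : ℕ} {ω : ℤ → A × Bool} {k p : ℤ} :
    Anchor F D (shift k ω) p ↔ Anchor F D ω (k + p) := by
  constructor
  · intro h j hj hj'
    have := h (j - k) (by omega) (by omega)
    rwa [shift, add_sub_cancel] at this
  · intro h j hj hj'
    exact h (k + j) (by omega) (by omega)

lemma anchored_shift {A : Type*} {F : Finset (Pattern A)} {D : ℕ} {ω : ℤ → A × Bool} {k : ℤ} :
    Anchored F D (shift k ω) ↔ Anchored F D ω := by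
  simp only [Anchored, anchor_shift]
  constructor
  · intro h m
    obtain ⟨⟨p, hp, hp'⟩, q, hq, hq'⟩ := h (m - k)
    exact ⟨⟨k + p, by omega, hp'⟩, k + q, by omega, hq'⟩
  · intro h m
    obtain ⟨⟨p, hp, hp'⟩, q, hq, hq'⟩ := h (m + k)
    exact ⟨⟨p - k, by omega, by rwa [add_sub_cancel]⟩, q - k, by omega, by rwa [add_sub_cancel]⟩

lemma Anchored.exists_isPrevAnchor {A : Type*} {F : Finset (Pattern A)} {D : ℕ}
    {ω : ℤ → A × Bool} (h : Anchored F D ω) (l : ℤ) : ∃ p, IsPrevAnchor F D ω l p := by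
  obtain ⟨p, hp, hp'⟩ := (h l).1
  have hb : BddAbove {p | p ≤ l ∧ Anchor F D ω p} := ⟨l, fun _ h => h.1⟩
  exact ⟨_, Int.csSup_mem ⟨p, hp, hp'⟩ hb, fun r hr => le_csSup hb hr⟩

lemma Anchored.exists_isNextAnchor {A : Type*} {F : Finset (Pattern A)} {D : ℕ}
    {ω : ℤ → A × Bool} (h : Anchored F D ω) (l : ℤ) : ∃ q, IsNextAnchor F D ω l q := by
  obtain ⟨q, hq, hq'⟩ := (h l).2
  have hb : BddBelow {q | l < q ∧ Anchor F D ω q} := ⟨l, fun _ h => h.1.le⟩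
  exact ⟨_, Int.csInf_mem ⟨q, hq, hq'⟩ hb, fun r hr => csInf_le hb hr⟩

lemma isPrevAnchor_shift {A : Type*} {F : Finset (Pattern A)} {D : ℕ} {ω : ℤ → A × Bool}
    {k l p : ℤ} (h : IsPrevAnchor F D (shift k ω) l p) : IsPrevAnchor F D ω (k + l) (k + p) := by
  refine ⟨⟨by have := h.1.1; omega, anchor_shift.1 h.1.2⟩, ?_⟩
  rintro r ⟨hr, hr'⟩
  have := h.2 (show r - k ∈ _ from ⟨by omega, anchor_shift.2 (by rwa [add_sub_cancel])⟩)
  omega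

lemma isNextAnchor_shift {A : Type*} {F : Finset (Pattern A)} {D : ℕ} {ω : ℤ → A × Bool}
    {k l q : ℤ} (h : IsNextAnchor F D (shift k ω) l q) : IsNextAnchor F D ω (k + l) (k + q) := by
  refine ⟨⟨by have := h.1.1; omega, anchor_shift.1 h.1.2⟩, ?_⟩
  rintro r ⟨hr, hr'⟩
  have := h.2 (show r - k ∈ _ from ⟨by omega, anchor_shift.2 (by rwa [add_sub_cancel])⟩)
  omega

/-- Every cell between consecutive anchors sees them as its neighbours. -/
lemma isPrevAnchor_isNextAnchor_of_mem {A : Type*} {F : Finset (Pattern A)} {D : ℕ}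
    {ω : ℤ → A × Bool} {l m p q : ℤ} (hp : IsPrevAnchor F D ω l p) (hq : IsNextAnchor F D ω l q)
    (hm : p ≤ m) (hm' : m < q) : IsPrevAnchor F D ω m p ∧ IsNextAnchor F D ω m q := by
  have hpl := hp.1.1
  have hlq := hq.1.1
  refine ⟨⟨⟨hm, hp.1.2⟩, ?_⟩, ⟨hm', hq.1.2⟩, ?_⟩
  · rintro r ⟨hr, hr'⟩
    rcases le_or_gt r l with h | h
    · exact hp.2 ⟨h, hr'⟩
    · have := hq.2 ⟨h, hr'⟩
      omega
  · rintro r ⟨hr, hr'⟩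
    rcases le_or_gt r l with h | h
    · have := hp.2 ⟨h, hr'⟩
      omega
    · exact hq.2 ⟨h, hr'⟩

/-- Two consecutive anchors are adjacent cells, or an obscured cell separates their clear
neighbourhoods, which then are disjoint. -/
lemma le_sub_of_isPrevAnchor {A : Type*} {F : Finset (Pattern A)} {D : ℕ} {ω : ℤ → A × Bool}
    {l p q : ℤ} (hp : IsPrevAnchor F D ω l p) (hq : IsNextAnchor F D ω l q) (hpq : q ≠ p + 1) :
    diam F + 2 * D + 2 ≤ q - p := by
  by_contra! hlt
  have hpl := hp.1.1
  have hlq := hq.1.1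
  have hanch : Anchor F D ω (p + 1) := by
    intro j hj hj'
    rcases le_or_gt j (p + diam F + D) with h | h
    · exact hp.1.2 j (by omega) h
    · exact hq.1.2 j (by omega) (by omega)
  rcases le_or_gt (p + 1) l with h | h
  · have := hp.2 ⟨h, hanch⟩
    omega
  · have := hq.2 ⟨h, hanch⟩
    omega

/-! ### Repairing a noisy configuration -/

/-- The configuration underlying a noisy configuration. -/
def proj {A : Type*} (ω : ℤ → A × Bool) : ℤ → A := fun k => (ω k).1

open Classical in
/-- A configuration of `Ω_F` with the word `s` at the cell `0` and `t` at the cell `n`. If there is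
none, the value is a constant configuration which still agrees with `s` at the cell `0`. -/
noncomputable def bridge {A : Type*} (F : Finset (Pattern A)) (s t : Fin (diam F + 1) → A)
    (n : ℤ) : ℤ → A :=
  if h : ∃ z ∈ sft F, window F z 0 = s ∧ window F z n = t then h.choose else fun _ => s 0

/-- The value at the cell `l` of the bridge between the words that `ω` shows at `p` and `q`. -/
noncomputable def glueAt {A : Type*} (F : Finset (Pattern A)) (ω : ℤ → A × Bool) (p q l : ℤ) : A :=
  bridge F (window F (proj ω) p) (window F (proj ω) q) (q - p) (l - p)

/-- Consecutive anchors of `ω` are joined by bridges. This is meaningful if `ω` is anchored. -/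
noncomputable def glue {A : Type*} (F : Finset (Pattern A)) (D : ℕ) (ω : ℤ → A × Bool) : ℤ → A :=
  fun l => glueAt F ω (sSup {p | p ≤ l ∧ Anchor F D ω p}) (sInf {q | l < q ∧ Anchor F D ω q}) l

lemma glue_eq {A : Type*} {F : Finset (Pattern A)} {D : ℕ} {ω : ℤ → A × Bool} {l p q : ℤ}
    (hp : IsPrevAnchor F D ω l p) (hq : IsNextAnchor F D ω l q) :
    glue F D ω l = glueAt F ω p q l := by
  rw [glue, hp.csSup_eq, hq.csInf_eq]

lemma glueAt_self {A : Type*} {F : Finset (Pattern A)} {ω : ℤ → A × Bool} {p q : ℤ} :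
    glueAt F ω p q p = proj ω p := by
  rw [glueAt, bridge, sub_self]
  split_ifs with h
  · simpa [window] using congrFun h.choose_spec.2.1 0
  · simp [window]

lemma window_shift {A : Type*} {F : Finset (Pattern A)} {x : ℤ → A} {k j : ℤ} :
    window F (shift k x) j = window F x (k + j) := by
  funext i
  simp only [window, shift, add_assoc]

lemma glueAt_shift {A : Type*} {F : Finset (Pattern A)} {ω : ℤ → A × Bool} {k p q l : ℤ} :
    glueAt F (shift k ω) p q l = glueAt F ω (k + p) (k + q) (k + l) := by
  have h : proj (shift k ω) = shift k (proj ω) := rfl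
  simp only [glueAt, h, window_shift, add_sub_add_left_eq_sub]

lemma glue_shift {A : Type*} {F : Finset (Pattern A)} {D : ℕ} {ω : ℤ → A × Bool}
    (h : Anchored F D ω) (k : ℤ) : glue F D (shift k ω) = shift k (glue F D ω) := by
  funext l
  obtain ⟨p, hp⟩ := (anchored_shift.2 h).exists_isPrevAnchor (ω := shift k ω) l
  obtain ⟨q, hq⟩ := (anchored_shift.2 h).exists_isNextAnchor (ω := shift k ω) l
  rw [glue_eq hp hq, shift, glue_eq (isPrevAnchor_shift hp) (isNextAnchor_shift hq), glueAt_shift]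

lemma shift_mem_sft {A : Type*} {F : Finset (Pattern A)} {x : ℤ → A} (hx : x ∈ sft F) (k : ℤ) :
    shift k x ∈ sft F := by
  rw [mem_sft_iff_window] at hx ⊢
  intro j
  rw [window_shift]
  exact hx _

lemma IsGluingConstant.exists_bridge {A : Type*} {F : Finset (Pattern A)} {n₀ : ℕ}
    (h : IsGluingConstant F n₀) {s t : Fin (diam F + 1) → A} (hs : GloballyAdmissible F s)
    (ht : GloballyAdmissible F t) {n : ℤ} (hn : diam F + 1 + n₀ ≤ n) :
    ∃ z ∈ sft F, window F z 0 = s ∧ window F z n = t := by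
  obtain ⟨w, z, hz, k, hk⟩ := h _ _ s t hs ht (n - (diam F + 1)).toNat (by omega)
  refine ⟨shift k z, shift_mem_sft hz k, ?_, ?_⟩
  · funext i
    have := hk (Fin.castAdd _ (Fin.castAdd _ i))
    rw [Fin.append_left, Fin.append_left] at this
    simpa [window, shift] using this
  · funext i
    have := hk (Fin.natAdd _ i)
    rw [Fin.append_right] at this
    rw [← this, window, shift]
    congr 1
    simp only [Fin.val_natAdd]
    omega

/-- Clear words of a noisy configuration without forbidden clear patterns are locally
admissible. -/
lemma locallyAdmissible_window_proj {A : Type*} {F : Finset (Pattern A)} {ω : ℤ → A × Bool}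
    (hω : ω ∈ sft (clearForbidden F)) {i : ℤ}
    (h : ∀ j, i ≤ j → j ≤ i + diam F → (ω j).2 = false) :
    LocallyAdmissible F (window F (proj ω) i) := by
  classical
  intro p hp k hk
  have hmem : clearPattern p ∈ clearForbidden F := Finset.mem_image_of_mem _ hp
  refine hω _ hmem (i + k) fun a => ?_
  obtain ⟨j, hj, hj'⟩ := hk a
  have hcell : i + (j : ℤ) = i + k + a := by rw [hj, add_assoc]
  refine Prod.ext ?_ ?_
  · rw [shift, ← hcell]
    exact hj'
  · rw [shift, ← hcell]
    exact h _ (by omega) (by have := j.2; omega)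

/-- At depth `k`, the number of transient states, the word at an anchor is a recurrent state. -/
lemma Anchor.globallyAdmissible {A : Type*} [Finite A] {F : Finset (Pattern A)}
    (hF : IsIrreducible F) {D : ℕ} (hD : transientCount F ≤ D) {ω : ℤ → A × Bool}
    (hω : ω ∈ sft (clearForbidden F)) {p : ℤ} (hp : Anchor F D ω p) :
    GloballyAdmissible F (window F (proj ω) p) := by
  obtain ⟨z, hz, hzw⟩ := (hF.recurrent_window (x := proj ω) (j := p) fun i hi hi' =>
    locallyAdmissible_window_proj hω fun j hj hj' =>
      hp j (by omega) (by omega)).exists_mem_sft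
  exact ⟨z, hz, 0, fun i => congrFun hzw i⟩

/-- Between consecutive anchors that are not adjacent, `glue` follows a configuration of `Ω_F`. -/
lemma glue_bridge {A : Type*} [Finite A] {F : Finset (Pattern A)} (hF : IsIrreducible F)
    {n₀ : ℕ} (hn₀ : IsGluingConstant F n₀) {D : ℕ} (hD : transientCount F ≤ D)
    (hD' : n₀ ≤ 2 * D) {ω : ℤ → A × Bool} (hω : ω ∈ sft (clearForbidden F)) {l p q : ℤ}
    (hp : IsPrevAnchor F D ω l p) (hq : IsNextAnchor F D ω l q) (hpq : q ≠ p + 1) :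
    ∃ z ∈ sft F, window F z p = window F (proj ω) p ∧ window F z q = window F (proj ω) q ∧
      ∀ m, p ≤ m → m < q → glue F D ω m = z m := by
  have hfar := le_sub_of_isPrevAnchor hp hq hpq
  have hex := hn₀.exists_bridge (hp.1.2.globallyAdmissible hF hD hω)
    (hq.1.2.globallyAdmissible hF hD hω) (n := q - p) (by omega)
  refine ⟨shift (-p) hex.choose, shift_mem_sft hex.choose_spec.1 _, ?_, ?_, fun m hm hm' => ?_⟩
  · rw [window_shift, neg_add_cancel]
    exact hex.choose_spec.2.1
  · rw [window_shift, neg_add_eq_sub]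
    exact hex.choose_spec.2.2
  · obtain ⟨hp', hq'⟩ := isPrevAnchor_isNextAnchor_of_mem hp hq hm hm'
    rw [glue_eq hp' hq', glueAt, bridge, dif_pos hex, shift, neg_add_eq_sub]

/-- `glue` leaves the words at the anchors unchanged. -/
lemma glue_eq_proj {A : Type*} [Finite A] {F : Finset (Pattern A)} (hF : IsIrreducible F)
    {n₀ : ℕ} (hn₀ : IsGluingConstant F n₀) {D : ℕ} (hD : transientCount F ≤ D)
    (hD' : n₀ ≤ 2 * D) {ω : ℤ → A × Bool} (hω : ω ∈ sft (clearForbidden F))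
    (ha : Anchored F D ω) {p l : ℤ} (hp : Anchor F D ω p) (hl : p ≤ l) (hl' : l ≤ p + diam F) :
    glue F D ω l = proj ω l := by
  obtain ⟨r, hr⟩ := ha.exists_isPrevAnchor l
  obtain ⟨q, hq⟩ := ha.exists_isNextAnchor l
  have hpr : p ≤ r := hr.2 ⟨hl, hp⟩
  have hrl := hr.1.1
  have hlq := hq.1.1
  by_cases h : q = r + 1
  · obtain rfl : r = l := by omega
    rw [glue_eq hr hq, glueAt_self]
  · obtain ⟨z, -, hzr, -, hz⟩ := glue_bridge hF hn₀ hD hD' hω hr hq h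
    rw [hz l hrl hlq]
    have := window_eq_iff.1 hzr (l - r) (by omega) (by omega)
    rwa [add_sub_cancel] at this

/-- The gaps are repaired: a window is contained in the word at an anchor, or in the stretch between
two consecutive anchors together with the word at the second one. -/
lemma glue_mem_sft {A : Type*} [Finite A] {F : Finset (Pattern A)} (hF : IsIrreducible F)
    {n₀ : ℕ} (hn₀ : IsGluingConstant F n₀) {D : ℕ} (hD : transientCount F ≤ D)
    (hD' : n₀ ≤ 2 * D) {ω : ℤ → A × Bool} (hω : ω ∈ sft (clearForbidden F))
    (ha : Anchored F D ω) : glue F D ω ∈ sft F := by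
  rw [mem_sft_iff_window]
  intro l
  obtain ⟨p, hp⟩ := ha.exists_isPrevAnchor l
  obtain ⟨q, hq⟩ := ha.exists_isNextAnchor l
  have hpl := hp.1.1
  have hlq := hq.1.1
  rcases eq_or_lt_of_le hpl with rfl | hpl
  · have : window F (glue F D ω) p = window F (proj ω) p := window_eq_iff.2 fun m hm hm' =>
      glue_eq_proj hF hn₀ hD hD' hω ha hp.1.2 (by omega) (by omega)
    rw [this]
    exact locallyAdmissible_window_proj hω fun j hj hj' => hp.1.2 j (by omega) (by omega)
  · obtain ⟨z, hzs, -, hzq, hz⟩ := glue_bridge hF hn₀ hD hD' hω hp hq (by omega)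
    have : window F (glue F D ω) l = window F z l := window_eq_iff.2 fun m hm hm' => by
      rcases lt_or_ge (l + m) q with h | h
      · exact hz _ (by omega) h
      · rw [glue_eq_proj hF hn₀ hD hD' hω ha hq.1.2 h (by omega)]
        have := window_eq_iff.1 hzq (l + m - q) (by omega) (by omega)
        rw [add_sub_cancel] at this
        exact this.symm
    rw [this]
    exact mem_sft_iff_window.1 hzs l

open Classical in
/-- The repaired configuration: glue `ω` along its anchors if they extend to both sides, and replace
it by `y` otherwise. -/
noncomputable def repair {A : Type*} (F : Finset (Pattern A)) (D : ℕ)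
    (w : (ℤ → A × Bool) × (ℤ → A)) : ℤ → A :=
  if Anchored F D w.1 then glue F D w.1 else w.2

lemma repair_shift {A : Type*} {F : Finset (Pattern A)} {D : ℕ} (k : ℤ)
    (w : (ℤ → A × Bool) × (ℤ → A)) :
    repair F D (shift k w.1, shift k w.2) = shift k (repair F D w) := by
  by_cases h : Anchored F D w.1
  · rw [repair, repair, if_pos h, if_pos (anchored_shift.2 h), glue_shift h]
  · rw [repair, repair, if_neg h, if_neg (mt anchored_shift.1 h)]

/-! ### Measurability -/

lemma measurable_shift {A : Type*} [MeasurableSpace A] (k : ℤ) :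
    Measurable (shift k : (ℤ → A) → ℤ → A) :=
  measurable_pi_lambda _ fun _ => measurable_pi_apply _

lemma measurable_proj {A : Type*} [MeasurableSpace A] :
    Measurable (proj : (ℤ → A × Bool) → ℤ → A) :=
  measurable_pi_lambda _ fun k => (measurable_pi_apply k).fst

lemma measurableSet_anchor {A : Type*} [MeasurableSpace A] (F : Finset (Pattern A)) (D : ℕ)
    (p : ℤ) : MeasurableSet {ω : ℤ → A × Bool | Anchor F D ω p} := by
  simp only [Anchor, Set.ofPred_forall]
  exact .iInter fun j => .iInter fun _ => .iInter fun _ =>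
    (measurable_pi_apply j).snd (measurableSet_singleton false)

lemma measurableSet_anchored {A : Type*} [MeasurableSpace A] (F : Finset (Pattern A)) (D : ℕ) :
    MeasurableSet {ω : ℤ → A × Bool | Anchored F D ω} := by
  simp only [Anchored, Set.ofPred_forall, Set.ofPred_and, Set.ofPred_exists]
  exact .iInter fun m => .inter
    (.iUnion fun p => .inter (.const _) (measurableSet_anchor F D p))
    (.iUnion fun p => .inter (.const _) (measurableSet_anchor F D p))

lemma measurableSet_isPrevAnchor {A : Type*} [MeasurableSpace A] (F : Finset (Pattern A)) (D : ℕ)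
    (l p : ℤ) : MeasurableSet {ω : ℤ → A × Bool | IsPrevAnchor F D ω l p} := by
  have : ∀ ω : ℤ → A × Bool, IsPrevAnchor F D ω l p ↔
      (p ≤ l ∧ Anchor F D ω p) ∧ ∀ r, r ≤ l → Anchor F D ω r → r ≤ p := fun ω =>
    ⟨fun h => ⟨h.1, fun r h1 h2 => h.2 ⟨h1, h2⟩⟩, fun h => ⟨h.1, fun r hr => h.2 r hr.1 hr.2⟩⟩
  simp only [this, Set.ofPred_and, Set.ofPred_forall]
  exact .inter (.inter (.const _) (measurableSet_anchor F D p)) (.iInter fun r => .iInter fun _ =>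
    (measurableSet_anchor F D r).imp (.const _))

lemma measurableSet_isNextAnchor {A : Type*} [MeasurableSpace A] (F : Finset (Pattern A)) (D : ℕ)
    (l q : ℤ) : MeasurableSet {ω : ℤ → A × Bool | IsNextAnchor F D ω l q} := by
  have : ∀ ω : ℤ → A × Bool, IsNextAnchor F D ω l q ↔
      (l < q ∧ Anchor F D ω q) ∧ ∀ r, l < r → Anchor F D ω r → q ≤ r := fun ω =>
    ⟨fun h => ⟨h.1, fun r h1 h2 => h.2 ⟨h1, h2⟩⟩, fun h => ⟨h.1, fun r hr => h.2 r hr.1 hr.2⟩⟩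
  simp only [this, Set.ofPred_and, Set.ofPred_forall]
  exact .inter (.inter (.const _) (measurableSet_anchor F D q)) (.iInter fun r => .iInter fun _ =>
    (measurableSet_anchor F D r).imp (.const _))

lemma measurable_glueAt {A : Type*} [Finite A] [MeasurableSpace A] [DiscreteMeasurableSpace A]
    (F : Finset (Pattern A)) (p q l : ℤ) :
    Measurable fun ω : ℤ → A × Bool => glueAt F ω p q l := by
  have hw : ∀ p : ℤ, Measurable fun ω : ℤ → A × Bool => window F (proj ω) p := fun p =>
    measurable_pi_lambda _ fun _ => (measurable_pi_apply _).comp measurable_proj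
  exact (Measurable.of_discrete (f := fun st : (Fin (diam F + 1) → A) × (Fin (diam F + 1) → A) =>
    bridge F st.1 st.2 (q - p) (l - p))).comp ((hw p).prodMk (hw q))

lemma measurable_repair {A : Type*} [Finite A] [MeasurableSpace A] [DiscreteMeasurableSpace A]
    (F : Finset (Pattern A)) (D : ℕ) : Measurable (repair F D) := by
  refine measurable_pi_lambda _ fun l => measurable_to_countable' fun c => ?_
  have : (fun w : (ℤ → A × Bool) × (ℤ → A) => repair F D w l) ⁻¹' {c} =
      (Prod.fst ⁻¹' {ω | Anchored F D ω} ∩ ⋃ p, ⋃ q, Prod.fst ⁻¹'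
        ({ω | IsPrevAnchor F D ω l p} ∩ {ω | IsNextAnchor F D ω l q} ∩
          (fun ω => glueAt F ω p q l) ⁻¹' {c})) ∪
      ((Prod.fst ⁻¹' {ω | Anchored F D ω})ᶜ ∩
        (fun w : (ℤ → A × Bool) × (ℤ → A) => w.2 l) ⁻¹' {c}) := by
    ext ⟨ω, y⟩
    by_cases h : Anchored F D ω
    · simp only [repair, h, Set.mem_preimage, Set.mem_union, Set.mem_inter_iff, Set.mem_compl_iff,
        Set.mem_ofPred_eq, Set.mem_iUnion, Set.mem_singleton_iff, if_true, true_and, not_true,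
        false_and, or_false]
      constructor
      · intro hc
        obtain ⟨p, hp⟩ := h.exists_isPrevAnchor l
        obtain ⟨q, hq⟩ := h.exists_isNextAnchor l
        exact ⟨p, q, ⟨hp, hq⟩, by rw [← glue_eq hp hq, hc]⟩
      · rintro ⟨p, q, ⟨hp, hq⟩, hc⟩
        rw [glue_eq hp hq, hc]
    · simp [repair, h]
  rw [this]
  refine .union (.inter (measurable_fst (measurableSet_anchored F D)) (.iUnion fun p =>
    .iUnion fun q => measurable_fst (.inter (.inter (measurableSet_isPrevAnchor F D l p)
      (measurableSet_isNextAnchor F D l q)) (measurable_glueAt F p q l (.singleton c))))) ?_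
  exact .inter (measurable_fst (measurableSet_anchored F D)).compl
    (((measurable_pi_apply l).comp measurable_snd) (.singleton c))

/-! ### An ergodic inequality for upper frequencies of visits -/

/-- The maximal function `x ↦ max (0, S₁ f x, …, Sₙ f x)` of the Birkhoff sums, by recursion. -/
noncomputable def maxBirkhoffSum {Ω : Type*} (T : Ω → Ω) (f : Ω → ℝ) : ℕ → Ω → ℝ
  | 0 => fun _ => 0
  | n + 1 => fun x => max 0 (f x + maxBirkhoffSum T f n (T x))

section maximal

variable {Ω : Type*} {T : Ω → Ω} {f : Ω → ℝ}

lemma maxBirkhoffSum_nonneg (n : ℕ) (x : Ω) : 0 ≤ maxBirkhoffSum T f n x := by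
  cases n with
  | zero => exact le_rfl
  | succ n => exact le_max_left _ _

lemma birkhoffSum_le_maxBirkhoffSum (n : ℕ) (x : Ω) :
    birkhoffSum T f n x ≤ maxBirkhoffSum T f n x := by
  induction n generalizing x with
  | zero => simp [maxBirkhoffSum]
  | succ n ih =>
    rw [birkhoffSum_succ']
    exact (add_le_add_right (ih (T x)) (f x)).trans (le_max_right _ _)

lemma maxBirkhoffSum_le_succ (n : ℕ) (x : Ω) :
    maxBirkhoffSum T f n x ≤ maxBirkhoffSum T f (n + 1) x := by
  induction n generalizing x with
  | zero => exact le_max_left _ _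
  | succ n ih => exact max_le_max le_rfl (add_le_add_right (ih (T x)) (f x))

lemma maxBirkhoffSum_le {B : ℝ} (hB : ∀ x, f x ≤ B) (hB0 : 0 ≤ B) (n : ℕ) (x : Ω) :
    maxBirkhoffSum T f n x ≤ n * B := by
  induction n generalizing x with
  | zero => simp [maxBirkhoffSum]
  | succ n ih =>
    refine max_le (by positivity) ?_
    have := add_le_add (hB x) (ih (T x))
    push_cast
    linarith

variable [MeasurableSpace Ω] {P : Measure Ω} [IsProbabilityMeasure P]

lemma measurable_maxBirkhoffSum (hT : Measurable T) (hf : Measurable f) (n : ℕ) :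
    Measurable (maxBirkhoffSum T f n) := by
  induction n with
  | zero => exact measurable_const
  | succ n ih => exact measurable_const.max (hf.add (ih.comp hT))

lemma integrable_maxBirkhoffSum (hT : Measurable T) (hf : Measurable f) {B : ℝ}
    (hB : ∀ x, |f x| ≤ B) (n : ℕ) : Integrable (maxBirkhoffSum T f n) P := by
  have hB' : ∀ x, f x ≤ B := fun x => (le_abs_self _).trans (hB x)
  refine .of_bound (measurable_maxBirkhoffSum hT hf n).aestronglyMeasurable (n * |B|)
    (.of_forall fun x => ?_)
  rw [Real.norm_of_nonneg (maxBirkhoffSum_nonneg n x)]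
  exact maxBirkhoffSum_le (fun x => (hB' x).trans (le_abs_self B)) (abs_nonneg B) n x

/-- The maximal ergodic theorem, for functions whose Birkhoff sums are positive at some time. -/
lemma integral_nonneg_of_maxBirkhoffSum_pos (hT : MeasurePreserving T P P) (hf : Measurable f)
    {B : ℝ} (hB : ∀ x, |f x| ≤ B) (hpos : ∀ x, ∃ n, 0 < maxBirkhoffSum T f n x) :
    0 ≤ ∫ x, f x ∂P := by
  have hfi : Integrable f P :=
    .of_bound hf.aestronglyMeasurable B (.of_forall hB)
  have hm := fun n => measurable_maxBirkhoffSum (T := T) hT.measurable hf n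
  have hi := fun n => integrable_maxBirkhoffSum (P := P) hT.measurable hf hB n
  let S : ℕ → Set Ω := fun n => {x | 0 < maxBirkhoffSum T f n x}
  have hS : ∀ n, MeasurableSet (S n) := fun n => measurableSet_lt measurable_const (hm n)
  have hmono : Monotone S := monotone_nat_of_le_succ fun n x hx =>
    lt_of_lt_of_le hx (maxBirkhoffSum_le_succ n x)
  have hcomp : ∀ n, Integrable (fun x => maxBirkhoffSum T f n (T x)) P := fun n =>
    hT.integrable_comp_of_integrable (hi n)
  have hstep : ∀ n, 0 ≤ ∫ x in S (n + 1), f x ∂P := by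
    intro n
    -- on `S (n + 1)` the maximum is attained by `f + maxBirkhoffSum T f n ∘ T`
    have h1 : ∫ x in S (n + 1), f x ∂P = ∫ x in S (n + 1), maxBirkhoffSum T f (n + 1) x ∂P -
        ∫ x in S (n + 1), maxBirkhoffSum T f n (T x) ∂P := by
      rw [← integral_sub (hi _).integrableOn (hcomp n).integrableOn]
      refine setIntegral_congr_fun (hS _) fun x hx => ?_
      have hx' : 0 < max 0 (f x + maxBirkhoffSum T f n (T x)) := hx
      have hx'' : 0 < f x + maxBirkhoffSum T f n (T x) := by simpa using hx'
      simp only [maxBirkhoffSum, max_eq_right hx''.le]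
      ring
    have h2 : ∫ x in S (n + 1), maxBirkhoffSum T f (n + 1) x ∂P =
        ∫ x, maxBirkhoffSum T f (n + 1) x ∂P := by
      refine setIntegral_eq_integral_of_forall_compl_eq_zero fun x hx => ?_
      exact le_antisymm (not_lt.1 hx) (maxBirkhoffSum_nonneg _ x)
    have h3 : ∫ x in S (n + 1), maxBirkhoffSum T f n (T x) ∂P ≤
        ∫ x, maxBirkhoffSum T f n (T x) ∂P :=
      setIntegral_le_integral (hcomp n) (.of_forall fun x => maxBirkhoffSum_nonneg _ _)
    have h4 : ∫ x, maxBirkhoffSum T f n (T x) ∂P = ∫ x, maxBirkhoffSum T f n x ∂P := by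
      rw [← integral_map hT.measurable.aemeasurable
        (by rw [hT.map_eq]; exact (hm n).aestronglyMeasurable), hT.map_eq]
    have h5 : ∫ x, maxBirkhoffSum T f n x ∂P ≤ ∫ x, maxBirkhoffSum T f (n + 1) x ∂P :=
      integral_mono (hi _) (hi _) (maxBirkhoffSum_le_succ n)
    linarith
  have hU : ⋃ n, S n = Set.univ := Set.eq_univ_of_forall fun x => Set.mem_iUnion.2 (hpos x)
  have hlim := tendsto_setIntegral_of_monotone hS hmono (f := f) (μ := P) hfi.integrableOn
  rw [hU, setIntegral_univ] at hlim
  exact ge_of_tendsto' ((tendsto_add_atTop_iff_nat 1).2 hlim) hstep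

end maximal

/-- The frequency of the visits of `x, T x, …, T^(n-1) x` to `s`. -/
noncomputable def visitFreq {Ω : Type*} (T : Ω → Ω) (s : Set Ω) (n : ℕ) (x : Ω) : ℝ :=
  (n : ℝ)⁻¹ * birkhoffSum T (s.indicator 1) n x

/-- The upper frequency of the visits of the forward orbit of `x` to `s`. -/
noncomputable def upperFreq {Ω : Type*} (T : Ω → Ω) (s : Set Ω) (x : Ω) : ℝ :=
  limsup (fun n => visitFreq T s n x) atTop

section frequency

variable {Ω : Type*} {T : Ω → Ω} {s : Set Ω}

lemma birkhoffSum_indicator_mem (n : ℕ) (x : Ω) :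
    birkhoffSum T (s.indicator (1 : Ω → ℝ)) n x ∈ Set.Icc 0 (n : ℝ) := by
  constructor
  · exact Finset.sum_nonneg fun k _ => Set.indicator_nonneg (fun _ _ => zero_le_one) _
  · refine (Finset.sum_le_card_nsmul _ _ 1 fun k _ => ?_).trans (by simp)
    exact Set.indicator_le_self' (fun _ _ => zero_le_one) _

lemma visitFreq_mem (n : ℕ) (x : Ω) : visitFreq T s n x ∈ Set.Icc (0 : ℝ) 1 := by
  obtain ⟨h0, h1⟩ := birkhoffSum_indicator_mem (T := T) (s := s) n x
  refine ⟨mul_nonneg (by positivity) h0, ?_⟩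
  refine (mul_le_mul_of_nonneg_left h1 (by positivity)).trans ?_
  exact inv_mul_le_one

lemma isBoundedUnder_visitFreq (x : Ω) :
    IsBoundedUnder (· ≤ ·) atTop fun n => visitFreq T s n x :=
  isBoundedUnder_of ⟨1, fun n => (visitFreq_mem n x).2⟩

lemma isCoboundedUnder_visitFreq (x : Ω) :
    IsCoboundedUnder (· ≤ ·) atTop fun n => visitFreq T s n x :=
  (isBoundedUnder_of (r := (· ≥ ·)) ⟨0, fun n => (visitFreq_mem n x).1⟩).isCoboundedUnder_flip

lemma upperFreq_mem (x : Ω) : upperFreq T s x ∈ Set.Icc (0 : ℝ) 1 :=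
  ⟨le_limsup_of_frequently_le (Frequently.of_forall fun n => (visitFreq_mem n x).1)
    (isBoundedUnder_visitFreq x),
  limsup_le_of_le (isCoboundedUnder_visitFreq x) (.of_forall fun n => (visitFreq_mem n x).2)⟩

lemma upperFreq_apply_le (x : Ω) : upperFreq T s (T x) ≤ upperFreq T s x := by
  refine le_of_forall_lt fun c hc => ?_
  obtain ⟨c₁, hc₁, hc₁'⟩ := exists_between hc
  obtain ⟨c₂, hc₂, hc₂'⟩ := exists_between hc₁'
  refine lt_of_lt_of_le hc₁ (le_limsup_of_frequently_le ?_ (isBoundedUnder_visitFreq x))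
  have hfreq := frequently_lt_of_lt_limsup (isCoboundedUnder_visitFreq (T x)) hc₂'
  have hsmall : ∀ᶠ n : ℕ in atTop, (n : ℝ)⁻¹ < c₂ - c₁ :=
    (tendsto_inv_atTop_nhds_zero_nat (𝕜 := ℝ)).eventually_lt_const (sub_pos.2 hc₂)
  have : ∃ᶠ n in atTop, c₁ ≤ visitFreq T s (n + 1) x := by
    refine (hfreq.and_eventually (hsmall.and (eventually_gt_atTop 0))).mono ?_
    rintro n ⟨h1, h2, h3⟩
    have hn : (0 : ℝ) < n := by exact_mod_cast h3
    have hs : birkhoffSum T (s.indicator 1) n (T x) ≤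
        birkhoffSum T (s.indicator (1 : Ω → ℝ)) (n + 1) x := by
      rw [birkhoffSum_succ']
      exact le_add_of_nonneg_left (Set.indicator_nonneg (fun _ _ => zero_le_one) _)
    have hmul : ((n + 1 : ℕ) : ℝ) * visitFreq T s (n + 1) x =
        birkhoffSum T (s.indicator (1 : Ω → ℝ)) (n + 1) x := by
      rw [visitFreq, mul_inv_cancel_left₀ (by positivity)]
    have hmul' : (n : ℝ) * visitFreq T s n (T x) =
        birkhoffSum T (s.indicator (1 : Ω → ℝ)) n (T x) := by
      rw [visitFreq, mul_inv_cancel_left₀ hn.ne']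
    have h4 := (visitFreq_mem (T := T) (s := s) (n + 1) x).2
    have h5 : 1 < (c₂ - c₁) * n := by
      rwa [inv_lt_iff_one_lt_mul₀ hn] at h2
    push_cast at hmul
    have h6 : (n : ℝ) * c₂ < n * visitFreq T s n (T x) := mul_lt_mul_of_pos_left h1 hn
    have h7 : (n : ℝ) * c₁ < n * visitFreq T s (n + 1) x := by linarith
    exact (lt_of_mul_lt_mul_left h7 hn.le).le
  rw [← map_add_atTop_eq_nat 1, frequently_map]
  exact this

lemma upperFreq_iterate_le (n : ℕ) (x : Ω) : upperFreq T s (T^[n] x) ≤ upperFreq T s x := by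
  induction n with
  | zero => exact le_rfl
  | succ n ih =>
    rw [Function.iterate_succ_apply']
    exact (upperFreq_apply_le _).trans ih

variable [MeasurableSpace Ω] {P : Measure Ω} [IsProbabilityMeasure P]

lemma measurable_upperFreq (hT : Measurable T) (hs : MeasurableSet s) :
    Measurable (upperFreq T s) := by
  refine Measurable.limsup fun n => ?_
  refine measurable_const.mul ?_
  exact Finset.measurable_sum _ fun k _ => (measurable_one.indicator hs).comp (hT.iterate k)

/-- The easy half of the pointwise ergodic theorem: the upper frequency of the visits to `s` has
mean at most `P s`. -/
lemma integral_upperFreq_le (hT : MeasurePreserving T P P) (hs : MeasurableSet s) :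
    ∫ x, upperFreq T s x ∂P ≤ P.real s := by
  refine le_of_forall_pos_le_add fun δ hδ => ?_
  have hmeas := measurable_upperFreq hT.measurable hs
  have hgm : Measurable (s.indicator (1 : Ω → ℝ)) := measurable_one.indicator hs
  have hg : ∀ x, s.indicator (1 : Ω → ℝ) x ∈ Set.Icc (0 : ℝ) 1 := fun x =>
    ⟨Set.indicator_nonneg (fun _ _ => zero_le_one) _,
      Set.indicator_le_self' (fun _ _ => zero_le_one) _⟩
  have hgi : Integrable (s.indicator (1 : Ω → ℝ)) P :=
    .of_bound hgm.aestronglyMeasurable 1 (.of_forall fun x => by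
      rw [Real.norm_of_nonneg (hg x).1]; exact (hg x).2)
  have hui : Integrable (upperFreq T s) P :=
    .of_bound hmeas.aestronglyMeasurable 1 (.of_forall fun x => by
      rw [Real.norm_of_nonneg (upperFreq_mem x).1]; exact (upperFreq_mem x).2)
  have key : 0 ≤ ∫ x, (s.indicator 1 x - upperFreq T s x + δ) ∂P := by
    refine integral_nonneg_of_maxBirkhoffSum_pos hT ((hgm.sub hmeas).add_const δ) (B := 1 + δ)
      (fun x => ?_) fun x => ?_
    · have h1 := hg x
      have h2 := upperFreq_mem (T := T) (s := s) x
      rw [abs_le]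
      constructor <;> linarith [h1.1, h1.2, h2.1, h2.2]
    -- some frequency exceeds the upper one up to `δ`, and `upperFreq` decreases along orbits
    · obtain ⟨n, hn, hn0⟩ := ((frequently_lt_of_lt_limsup (isCoboundedUnder_visitFreq x)
        (show upperFreq T s x - δ < _ from sub_lt_self _ hδ)).and_eventually
          (eventually_gt_atTop 0)).exists
      have hn' : (0 : ℝ) < n := by exact_mod_cast hn0
      refine ⟨n, lt_of_lt_of_le ?_ (birkhoffSum_le_maxBirkhoffSum n x)⟩
      have h1 : (n : ℝ) * visitFreq T s n x =
          ∑ k ∈ Finset.range n, s.indicator (1 : Ω → ℝ) (T^[k] x) := by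
        rw [visitFreq, mul_inv_cancel_left₀ hn'.ne']
        rfl
      have h2 : ∑ k ∈ Finset.range n, upperFreq T s (T^[k] x) ≤ n * upperFreq T s x := by
        refine (Finset.sum_le_card_nsmul _ _ _ fun k _ => upperFreq_iterate_le k x).trans ?_
        simp
      have h3 : (n : ℝ) * (upperFreq T s x - δ) < n * visitFreq T s n x :=
        mul_lt_mul_of_pos_left hn hn'
      simp only [birkhoffSum, Finset.sum_add_distrib, Finset.sum_sub_distrib, Finset.sum_const,
        Finset.card_range, nsmul_eq_mul]
      linarith
  rw [integral_add (f := fun x => s.indicator 1 x - upperFreq T s x) (hgi.sub hui)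
    (integrable_const _), integral_sub hgi hui,
    integral_indicator_one hs] at key
  simp only [integral_const, probReal_univ, smul_eq_mul, one_mul] at key
  linarith

lemma lintegral_upperFreq_le (hT : MeasurePreserving T P P) (hs : MeasurableSet s) :
    ∫⁻ x, ENNReal.ofReal (upperFreq T s x) ∂P ≤ P s := by
  have hmeas := measurable_upperFreq hT.measurable hs
  have hui : Integrable (upperFreq T s) P :=
    .of_bound hmeas.aestronglyMeasurable 1 (.of_forall fun x => by
      rw [Real.norm_of_nonneg (upperFreq_mem x).1]; exact (upperFreq_mem x).2)
  rw [← ofReal_integral_eq_lintegral_ofReal hui (.of_forall fun x => (upperFreq_mem x).1),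
    ← ofReal_measureReal]
  exact ENNReal.ofReal_le_ofReal (integral_upperFreq_le hT hs)

end frequency

/-! ### The Besicovitch distance of an invariant coupling -/

lemma shift_shift {A : Type*} (j k : ℤ) (x : ℤ → A) : shift j (shift k x) = shift (k + j) x := by
  funext l
  simp only [shift, add_assoc]

lemma shift_iterate {A : Type*} (k : ℤ) (n : ℕ) (x : ℤ → A) :
    (shift k)^[n] x = shift (n * k) x := by
  induction n with
  | zero => funext l; simp [shift]
  | succ n ih =>
    rw [Function.iterate_succ_apply', ih, shift_shift]
    congr 1
    push_cast
    ring

/-- The pairs of configurations that differ at the cell `0`. -/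
def mismatch (A : Type*) : Set (ℤ → A × A) := {z | (z 0).1 ≠ (z 0).2}

lemma measurableSet_mismatch {A : Type*} [Finite A] [MeasurableSpace A]
    [DiscreteMeasurableSpace A] : MeasurableSet (mismatch A) :=
  (measurable_pi_apply (X := fun _ : ℤ => A × A) 0)
    (MeasurableSet.of_discrete (s := {a : A × A | a.1 ≠ a.2}))

open Classical in
lemma birkhoffSum_mismatch {A : Type*} (k : ℤ) (n : ℕ) (z : ℤ → A × A) :
    birkhoffSum (shift k) ((mismatch A).indicator (1 : (ℤ → A × A) → ℝ)) n z =
      (((Finset.range n).filter fun i : ℕ => (z (i * k)).1 ≠ (z (i * k)).2).card : ℝ) := by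
  rw [birkhoffSum, Finset.card_filter]
  push_cast
  refine Finset.sum_congr rfl fun i _ => ?_
  rw [shift_iterate, Set.indicator_apply]
  simp [mismatch, shift]

/-- A box centred at `0` is covered by a forward and a backward stretch of the orbit. -/
lemma hammingBesicovitch_le {A : Type*} (z : ℤ → A × A) :
    hammingBesicovitch (fun k => (z k).1) (fun k => (z k).2) ≤
      ENNReal.ofReal (upperFreq (shift 1) (mismatch A) z) +
        ENNReal.ofReal (upperFreq (shift (-1)) (mismatch A) z) := by
  classical
  have hp := upperFreq_mem (T := shift 1) (s := mismatch A) z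
  have hm := upperFreq_mem (T := shift (-1)) (s := mismatch A) z
  rw [← ENNReal.ofReal_add hp.1 hm.1]
  refine ENNReal.le_of_forall_pos_le_add fun δ hδ _ => ?_
  have hδ' : (0 : ℝ) < δ / 2 := by positivity
  rw [← ENNReal.ofReal_coe_nnreal, ← ENNReal.ofReal_add (add_nonneg hp.1 hm.1) δ.coe_nonneg]
  refine limsup_le_of_le (by isBoundedDefault) ?_
  have h1 : ∀ᶠ n in atTop, visitFreq (shift 1) (mismatch A) n z <
      upperFreq (shift 1) (mismatch A) z + δ / 2 :=
    eventually_lt_of_limsup_lt (lt_add_of_pos_right _ hδ') (isBoundedUnder_visitFreq z)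
  have h2 : ∀ᶠ n in atTop, visitFreq (shift (-1)) (mismatch A) n z <
      upperFreq (shift (-1)) (mismatch A) z + δ / 2 :=
    eventually_lt_of_limsup_lt (lt_add_of_pos_right _ hδ') (isBoundedUnder_visitFreq z)
  filter_upwards [(tendsto_add_atTop_nat 1).eventually h1,
    (tendsto_add_atTop_nat 1).eventually h2] with n h1 h2
  rw [visitFreq, birkhoffSum_mismatch] at h1 h2
  set a := (Finset.range (n + 1)).filter fun i : ℕ =>
    (z ((i : ℤ) * 1)).1 ≠ (z ((i : ℤ) * 1)).2
  set b := (Finset.range (n + 1)).filter fun i : ℕ =>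
    (z ((i : ℤ) * -1)).1 ≠ (z ((i : ℤ) * -1)).2
  have hcard : ((Finset.Icc (-(n : ℤ)) n).filter fun k => (z k).1 ≠ (z k).2).card ≤
      a.card + b.card := by
    refine (Finset.card_le_card (t := a.image (fun i : ℕ => (i : ℤ) * 1) ∪
      b.image (fun i : ℕ => (i : ℤ) * -1)) fun k hk => ?_).trans ((Finset.card_union_le _ _).trans
        (add_le_add Finset.card_image_le Finset.card_image_le))
    simp only [Finset.mem_filter, Finset.mem_Icc] at hk
    obtain ⟨⟨hk1, hk2⟩, hk3⟩ := hk
    rw [Finset.mem_union]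
    rcases le_total 0 k with h | h
    · have hk : ((k.toNat : ℕ) : ℤ) * 1 = k := by omega
      refine .inl (Finset.mem_image.2 ⟨k.toNat, Finset.mem_filter.2 ⟨?_, by rwa [hk]⟩, hk⟩)
      exact Finset.mem_range.2 (by omega)
    · have hk : (((-k).toNat : ℕ) : ℤ) * -1 = k := by omega
      refine .inr (Finset.mem_image.2 ⟨(-k).toNat, Finset.mem_filter.2 ⟨?_, by rwa [hk]⟩, hk⟩)
      exact Finset.mem_range.2 (by omega)
  rw [← ENNReal.ofReal_natCast, ← ENNReal.ofReal_natCast,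
    ← ENNReal.ofReal_div_of_pos (by positivity)]
  refine ENNReal.ofReal_le_ofReal ?_
  have hn : (0 : ℝ) < ((n + 1 : ℕ) : ℝ) := by positivity
  calc _ ≤ ((a.card + b.card : ℕ) : ℝ) / ((n + 1 : ℕ) : ℝ) := by
        gcongr
        omega
    _ = ((n + 1 : ℕ) : ℝ)⁻¹ * a.card + ((n + 1 : ℕ) : ℝ)⁻¹ * b.card := by
        push_cast
        ring
    _ ≤ _ := by linarith

lemma measurePreserving_shift {A : Type*} [MeasurableSpace A] {l : Measure (ℤ → A)}
    (hl : l ∈ invariantMeasures A) (k : ℤ) : MeasurePreserving (shift k) l l :=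
  ⟨measurable_shift k, hl.2 k⟩

/-- The cost of an invariant coupling, up to a factor `2` which the symmetric boxes of `d_H` and the
one-sided ergodic inequality bring about. -/
lemma lintegral_hammingBesicovitch_le {A : Type*} [Finite A] [MeasurableSpace A]
    [DiscreteMeasurableSpace A] {l : Measure (ℤ → A × A)} (hl : l ∈ invariantMeasures (A × A)) :
    ∫⁻ z, hammingBesicovitch (fun k => (z k).1) (fun k => (z k).2) ∂l ≤ 2 * l (mismatch A) := by
  have := hl.1
  have hs := measurableSet_mismatch (A := A)
  calc _ ≤ _ := lintegral_mono hammingBesicovitch_le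
    _ = _ := lintegral_add_left
        (measurable_upperFreq (measurable_shift 1) hs).ennreal_ofReal _
    _ ≤ l (mismatch A) + l (mismatch A) :=
        add_le_add (lintegral_upperFreq_le (measurePreserving_shift hl 1) hs)
          (lintegral_upperFreq_le (measurePreserving_shift hl (-1)) hs)
    _ = _ := (two_mul _).symm

/-! ### An invariant measure on the subshift -/

lemma mem_invariantMeasures_of_shift_one {A : Type*} [MeasurableSpace A] {μ : Measure (ℤ → A)}
    (hμ : IsProbabilityMeasure μ) (h : μ.map (shift 1) = μ) : μ ∈ invariantMeasures A := by
  have hcomp : ∀ j k : ℤ, (μ.map (shift k)).map (shift j) = μ.map (shift (k + j)) := by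
    intro j k
    rw [Measure.map_map (measurable_shift j) (measurable_shift k)]
    congr 1
    funext x
    exact shift_shift j k x
  have hzero : μ.map (shift 0) = μ := by
    have : (shift 0 : (ℤ → A) → ℤ → A) = id := by
      funext x l
      simp [shift]
    rw [this, Measure.map_id]
  have hnat : ∀ n : ℕ, μ.map (shift n) = μ := by
    intro n
    induction n with
    | zero => exact hzero
    | succ n ih => rw [Nat.cast_succ, ← hcomp, ih, h]
  refine ⟨hμ, fun k => ?_⟩
  obtain ⟨n, rfl | rfl⟩ := k.eq_nat_or_neg
  · exact hnat n
  · have := hcomp (-n) n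
    rwa [hnat, add_neg_cancel, hzero] at this

lemma measurableSet_sft {A : Type*} [Finite A] [MeasurableSpace A] [DiscreteMeasurableSpace A]
    (F : Finset (Pattern A)) : MeasurableSet (sft F) := by
  have : sft F = ⋂ j, (fun y => window F y j) ⁻¹' {u | LocallyAdmissible F u} := by
    ext y
    simp [mem_sft_iff_window]
  rw [this]
  exact .iInter fun j => (measurable_pi_lambda _ fun i => measurable_pi_apply _) .of_discrete

/-- The uniform measure on the orbit of a periodic point is invariant. -/
lemma IsIrreducible.exists_mem_sftMeasures {A : Type*} [Finite A] [MeasurableSpace A]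
    [DiscreteMeasurableSpace A] {F : Finset (Pattern A)} (hF : IsIrreducible F) :
    ∃ ν, ν ∈ sftMeasures F := by
  obtain ⟨-, ⟨s, ⟨⟨n, hn, hp⟩, -⟩, -⟩, -⟩ := hF
  obtain ⟨e, -, hstep, hper⟩ := exists_periodic_path hn hp
  obtain ⟨m, rfl⟩ : ∃ m, n = m + 1 := ⟨n - 1, by omega⟩
  set x := readPath e with hx
  have hxs : x ∈ sft F := readPath_mem_sft hstep
  have hxper : shift ((m + 1 : ℕ) : ℤ) x = shift 0 x := by
    funext l
    simp only [shift, hx, readPath, zero_add]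
    exact congrArg (fun t : State F => t.1 0) (by rw [add_comm, hper])
  let g : ℕ → Measure (ℤ → A) := fun i => Measure.dirac (shift i x)
  have hg : ∀ i, (g i).map (shift 1) = g (i + 1) := by
    intro i
    simp only [g]
    rw [Measure.map_dirac' (measurable_shift 1), shift_shift, Nat.cast_succ]
  let ν : Measure (ℤ → A) := ((m + 1 : ℕ) : ℝ≥0∞)⁻¹ • ∑ i ∈ Finset.range (m + 1), g i
  have hprob : IsProbabilityMeasure ν := by
    constructor
    have : (∑ i ∈ Finset.range (m + 1), g i) Set.univ = ((m + 1 : ℕ) : ℝ≥0∞) := by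
      rw [Measure.finsetSum_apply]
      simp [g]
    rw [Measure.smul_apply, this, smul_eq_mul]
    exact ENNReal.inv_mul_cancel (by simp) (ENNReal.natCast_ne_top _)
  have hinv : ν.map (shift 1) = ν := by
    simp only [ν]
    rw [Measure.map_smul, ← Measure.mapₗ_apply_of_measurable (measurable_shift 1), map_sum]
    simp only [Measure.mapₗ_apply_of_measurable (measurable_shift 1), hg]
    rw [Finset.sum_range_succ, Finset.sum_range_succ' _ m]
    congr 2
    simp only [g, hxper, Nat.cast_zero]
  refine ⟨ν, mem_invariantMeasures_of_shift_one hprob hinv, ?_⟩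
  refine Measure.ae_smul_measure ?_ _
  rw [ae_iff, Measure.finsetSum_apply]
  refine Finset.sum_eq_zero fun i _ => ?_
  have hmeas : MeasurableSet {y : ℤ → A | y ∉ sft F} := (measurableSet_sft F).compl
  simp only [g]
  rw [Measure.dirac_apply' _ hmeas, Set.indicator_of_notMem]
  exact fun h => h (shift_mem_sft hxs _)

/-! ### The repaired coupling -/

/-- By Poincaré recurrence, a noisy configuration with an anchor almost surely has anchors
arbitrarily far on both sides. -/
lemma ae_anchored {A : Type*} [MeasurableSpace A] (F : Finset (Pattern A)) (D : ℕ)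
    {l : Measure (ℤ → A × Bool)} (hl : l ∈ invariantMeasures (A × Bool)) :
    ∀ᵐ ω ∂l, ∀ p, Anchor F D ω p → Anchored F D ω := by
  have := hl.1
  refine ae_all_iff.2 fun p => ?_
  have hrec := fun k : ℤ =>
    (measurePreserving_shift hl k).conservative.ae_mem_imp_frequently_image_mem
      (measurableSet_anchor F D p).nullMeasurableSet
  filter_upwards [hrec 1, hrec (-1)] with ω h1 h2 hp m
  obtain ⟨i, hi, hi'⟩ := ((h2 hp).and_eventually (eventually_ge_atTop (p - m).toNat)).exists
  obtain ⟨j, hj, hj'⟩ := ((h1 hp).and_eventually (eventually_ge_atTop (m + 1 - p).toNat)).exists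
  rw [shift_iterate] at hi hj
  exact ⟨⟨_, by omega, anchor_shift.1 hi⟩, _, by omega, anchor_shift.1 hj⟩

/-- A given cell has an obscured cell within distance `E` with probability at most
`(2 E + 1) ε`. -/
lemma measure_exists_obscured_le {A : Type*} [MeasurableSpace A]
    {l : Measure (ℤ → A × Bool)}
    (hl : l ∈ invariantMeasures (A × Bool)) {ε : ℝ}
    (hε : IsNoise ε (l.map fun ω k => (ω k).2)) (E : ℕ) :
    l {ω | ∃ j ∈ Finset.Icc (-(E : ℤ)) E, (ω j).2 = true} ≤
      ((2 * E + 1 : ℕ) : ℝ≥0∞) * ENNReal.ofReal ε := by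
  have hm : Measurable fun (ω : ℤ → A × Bool) (k : ℤ) => (ω k).2 :=
    measurable_pi_lambda _ fun k => (measurable_pi_apply k).snd
  have h0 : l {ω | (ω 0).2 = true} ≤ ENNReal.ofReal ε := by
    have := hε.2
    have hset : MeasurableSet {b : ℤ → Bool | b 0 = true} :=
      measurable_pi_apply (X := fun _ : ℤ => Bool) 0 (measurableSet_singleton true)
    rwa [Measure.map_apply hm hset] at this
  have hj : ∀ j : ℤ, l {ω | (ω j).2 = true} ≤ ENNReal.ofReal ε := by
    intro j
    have hset : MeasurableSet {ω : ℤ → A × Bool | (ω 0).2 = true} :=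
      (measurable_pi_apply 0).snd (measurableSet_singleton true)
    have := Measure.map_apply (μ := l) (measurable_shift j) hset
    rw [hl.2] at this
    rw [this] at h0
    simpa [shift] using h0
  have hU : {ω : ℤ → A × Bool | ∃ j ∈ Finset.Icc (-(E : ℤ)) E, (ω j).2 = true} =
      ⋃ j ∈ Finset.Icc (-(E : ℤ)) E, {ω | (ω j).2 = true} := by
    ext ω
    simp
  rw [hU]
  refine (measure_biUnion_finset_le _ _).trans ((Finset.sum_le_card_nsmul _ _ _
    fun j _ => hj j).trans_eq ?_)
  rw [Int.card_Icc, nsmul_eq_mul]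
  congr 2
  omega

/-- The pair of the given configuration and of the repaired one. -/
noncomputable def pairRepair {A : Type*} (F : Finset (Pattern A)) (D : ℕ)
    (w : (ℤ → A × Bool) × (ℤ → A)) : ℤ → A × A :=
  fun k => (proj w.1 k, repair F D w k)

section coupling

variable {A : Type*} [Finite A] [MeasurableSpace A] [DiscreteMeasurableSpace A]

lemma measurable_pairRepair (F : Finset (Pattern A)) (D : ℕ) : Measurable (pairRepair F D) :=
  measurable_pi_lambda _ fun k =>
    ((measurable_pi_apply k).comp (measurable_proj.comp measurable_fst)).prodMk
      ((measurable_pi_apply k).comp (measurable_repair F D))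

lemma map_pairRepair_mem_invariantMeasures (F : Finset (Pattern A)) (D : ℕ)
    {l : Measure (ℤ → A × Bool)} (hl : l ∈ invariantMeasures (A × Bool)) {ν : Measure (ℤ → A)}
    (hν : ν ∈ invariantMeasures A) :
    (l.prod ν).map (pairRepair F D) ∈ invariantMeasures (A × A) := by
  have := hl.1
  have := hν.1
  have hm := measurable_pairRepair F D
  refine ⟨Measure.isProbabilityMeasure_map hm.aemeasurable, fun k => ?_⟩
  have hcomm : shift k ∘ pairRepair F D = pairRepair F D ∘ Prod.map (shift k) (shift k) := by
    funext w j
    refine Prod.ext rfl ?_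
    exact (congrFun (repair_shift (F := F) (D := D) k w) j).symm
  rw [Measure.map_map (measurable_shift k) hm, hcomm, ← Measure.map_map hm
    ((measurable_shift k).prodMap (measurable_shift k)),
    ← Measure.map_prod_map _ _ (measurable_shift k) (measurable_shift k), hl.2, hν.2]

/-- The repaired measure lies in `M_F`, and the repair costs at most twice the probability that the
`E`-neighbourhood of a cell is not clear. -/
lemma exists_besicovitch_le {F : Finset (Pattern A)} (hF : IsIrreducible F)
    {n₀ : ℕ} (hn₀ : IsGluingConstant F n₀) {ε : ℝ} {μ : Measure (ℤ → A)}
    (hμ : μ ∈ projectedNoisyMeasures F allNoises ε) :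
    ∃ ν ∈ sftMeasures F, besicovitch μ ν ≤
      2 * (((2 * constE F n₀ + 1 : ℕ) : ℝ≥0∞) * ENNReal.ofReal ε) := by
  obtain ⟨l, ⟨⟨hl, hls⟩, -, hε⟩, rfl⟩ := hμ
  obtain ⟨ν₀, hν₀, hν₀s⟩ := hF.exists_mem_sftMeasures
  have := hl.1
  have := hν₀.1
  set D := max (max (transientCount F) ((diam F + 1) / 2)) ((n₀ + 1) / 2)
  have hE : constE F n₀ = D + (diam F + 1) / 2 := rfl
  have hD : transientCount F ≤ D := (le_max_left _ _).trans (le_max_left _ _)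
  have hD' : n₀ ≤ 2 * D := by
    have : (n₀ + 1) / 2 ≤ D := le_max_right _ _
    omega
  have hm := measurable_pairRepair F D
  have hfst : Measurable fun (z : ℤ → A × A) (k : ℤ) => (z k).1 :=
    measurable_pi_lambda _ fun k => (measurable_pi_apply k).fst
  have hsnd : Measurable fun (z : ℤ → A × A) (k : ℤ) => (z k).2 :=
    measurable_pi_lambda _ fun k => (measurable_pi_apply k).snd
  have hinv := map_pairRepair_mem_invariantMeasures F D hl hν₀
  set L := (l.prod ν₀).map (pairRepair F D) with hL
  -- almost sure properties of a pair of independent configurations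
  have hae1 : ∀ᵐ w ∂l.prod ν₀, w.1 ∈ sft (clearForbidden F) :=
    Measure.quasiMeasurePreserving_fst.ae hls
  have hae2 : ∀ᵐ w ∂l.prod ν₀, w.2 ∈ sft F := Measure.quasiMeasurePreserving_snd.ae hν₀s
  have hae3 : ∀ᵐ w ∂l.prod ν₀, ∀ p, Anchor F D w.1 p → Anchored F D w.1 :=
    Measure.quasiMeasurePreserving_fst.ae (ae_anchored F D hl)
  have hcomp : L.map (fun z k => (z k).2) = (l.prod ν₀).map (repair F D) := by
    rw [hL, Measure.map_map hsnd hm]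
    rfl
  refine ⟨L.map fun z k => (z k).2, ⟨⟨?_, fun k => ?_⟩, ?_⟩, ?_⟩
  · have := hinv.1
    exact Measure.isProbabilityMeasure_map hsnd.aemeasurable
  · conv_rhs => rw [← hinv.2 k]
    rw [Measure.map_map (measurable_shift k) hsnd, Measure.map_map hsnd (measurable_shift k)]
    rfl
  · rw [hcomp]
    refine (ae_map_iff (p := fun x => x ∈ sft F) (measurable_repair F D).aemeasurable
      (measurableSet_sft F)).2 ?_
    filter_upwards [hae1, hae2] with w h1 h2
    by_cases h : Anchored F D w.1
    · rw [repair, if_pos h]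
      exact glue_mem_sft hF hn₀ hD hD' h1 h
    · rwa [repair, if_neg h]
  · have hcoup : L ∈ couplings (l.map fun ω k => (ω k).1) (L.map fun z k => (z k).2) := by
      refine ⟨hinv, ?_, rfl⟩
      rw [hL, Measure.map_map hfst hm]
      have : (fun (z : ℤ → A × A) (k : ℤ) => (z k).1) ∘ pairRepair F D = proj ∘ Prod.fst := rfl
      rw [this, ← Measure.map_map measurable_proj measurable_fst, Measure.map_fst_prod]
      simp only [measure_univ, one_smul]
      rfl
    refine (iInf₂_le L hcoup).trans ((lintegral_hammingBesicovitch_le hinv).trans ?_)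
    gcongr
    refine le_trans ?_ (measure_exists_obscured_le hl hε (constE F n₀))
    set O := {ω : ℤ → A × Bool |
      ∃ j ∈ Finset.Icc (-(constE F n₀ : ℤ)) (constE F n₀), (ω j).2 = true}
    have hprod : (l.prod ν₀) (O ×ˢ Set.univ) = l O := by
      rw [Measure.prod_prod, measure_univ, mul_one]
    rw [hL, Measure.map_apply hm measurableSet_mismatch, ← hprod]
    refine measure_mono_ae ?_
    filter_upwards [hae1, hae3] with w h1 h3 hw
    refine ⟨?_, Set.mem_univ _⟩
    by_contra hclear
    -- if the `E`-neighbourhood of `0` is clear, then `0` lies in the window of the anchor `-⌊d/2⌋`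
    have hanch : Anchor F D w.1 (-((diam F / 2 : ℕ) : ℤ)) := by
      intro j hj hj'
      by_contra hne
      exact hclear ⟨j, Finset.mem_Icc.2 ⟨by omega, by omega⟩, by simpa using hne⟩
    refine hw ?_
    change proj w.1 0 = repair F D w 0
    rw [repair, if_pos (h3 _ hanch)]
    exact (glue_eq_proj hF hn₀ hD hD' h1 (h3 _ hanch) hanch (by omega) (by omega)).symm

lemma IsAperiodic.isStable {F : Finset (Pattern A)} (hF : IsAperiodic F) {n₀ : ℕ}
    (hn₀ : IsGluingConstant F n₀) :
    IsStable F besicovitch allNoises (fun ε => 3 * (2 * (constE F n₀ : ℝ) + 1) * ε) := by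
  have hc : (0 : ℝ) ≤ 3 * (2 * (constE F n₀ : ℝ) + 1) := by positivity
  refine ⟨fun a _ b _ hab => mul_le_mul_of_nonneg_left hab hc, fun ε hε => mul_nonneg hc hε.1,
    mul_zero _, by fun_prop, fun ε hε => iSup₂_le fun μ hμ => ?_⟩
  obtain ⟨ν, hν, hle⟩ := exists_besicovitch_le hF.1 hn₀ hμ
  refine (iInf₂_le ν hν).trans (hle.trans ?_)
  have h2 : (2 : ℝ≥0∞) = ENNReal.ofReal 2 := by simp
  rw [h2, ← ENNReal.ofReal_natCast, ← ENNReal.ofReal_mul (by positivity),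
    ← ENNReal.ofReal_mul (by positivity)]
  refine ENNReal.ofReal_le_ofReal ?_
  push_cast
  have := mul_nonneg (show (0 : ℝ) ≤ 2 * (constE F n₀ : ℝ) + 1 by positivity) hε.1
  linarith

end coupling

end NoisySFT

theorem mainTheorem3 {A : Type*} [Finite A] [MeasurableSpace A] [DiscreteMeasurableSpace A]
    (F : Finset (NoisySFT.Pattern A)) (hF : NoisySFT.IsAperiodic F) :
    NoisySFT.IsLinearlyStable F NoisySFT.besicovitch NoisySFT.allNoises ∧
    (∃ n₀ : ℕ, NoisySFT.IsGluingConstant F n₀) ∧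
    ∀ n₀ : ℕ, NoisySFT.IsGluingConstant F n₀ →
      NoisySFT.IsStable F NoisySFT.besicovitch NoisySFT.allNoises
        (fun ε => 3 * (2 * (NoisySFT.constE F n₀ : ℝ) + 1) * ε) := by
  obtain ⟨n₀, hn₀⟩ := hF.exists_isGluingConstant
  exact ⟨⟨_, hF.isStable hn₀, (isBigO_refl _ _).const_mul_left _⟩, ⟨n₀, hn₀⟩,
    fun _ h => hF.isStable h⟩
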